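/- Let $q$ be a prime power, let $\ell\ge 1$, and let $m_1\ge m_2\ge\dots\ge m_\ell$ and $n_1,\dots,n_\ell$ be positive integers with $n_i\le m_i$ for all $i$. Let $\mathbb M=\mathbb F_q^{m_1\times n_1}\times\dots\times\mathbb F_q^{m_\ell\times n_\ell}$. A code is an $\mathbb F_q$-linear subspace $\mathcal A\subseteq\mathbb M$; it is called an optimal (sum-rank) anticode if $$\dim_{\mathbb F_q}(\mathcal A)=\max_{(C_1,\dots,C_\ell)\in\mathcal A}\ \sum_{i=1}^\ell m_i\,\mathrm{rk}(C_i).$$ The dual of $\mathcal A$ is $\mathcal A^\perp=\{D\in\mathbb M:\ \sum_{i=1}^\ell \mathrm{tr}(D_iC_i^{t})=0\ \text{ for all } C\in\mathcal A\}$. Assume that $q\neq 2$ or $m_{\ell-2}>1$, where the condition $m_{\ell-2}>1$ is regarded as satisfied if $\ell\le 2$. Then a code $\mathcal A\subseteq\mathbb M$ is an optimal anticode if and only if $\mathcal A^\perp$ is an optimal anticode. -/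

import Mathlib

namespace SumRank

/-- The ambient space `𝔽^{m₁ × n₁} × ⋯ × 𝔽^{m_ℓ × n_ℓ}` of tuples of matrices. -/
abbrev Ambient (F : Type*) {ℓ : ℕ} (m n : Fin ℓ → ℕ) : Type _ :=
  (i : Fin ℓ) → Matrix (Fin (m i)) (Fin (n i)) F

variable {F : Type*} [Field F] {ℓ : ℕ} {m n : Fin ℓ → ℕ}

/-- The quantity `∑ i, m_i * rk(C_i)` that occurs in the anticode bound. -/
noncomputable def weightedRank (C : Ambient F m n) : ℕ :=
  ∑ i, m i * (C i).rank

/-- A linear code is an optimal anticode if its dimension is equal to the maximum of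
`∑ i, m_i * rk(C_i)` over its elements. -/
def IsOptimalAnticode (A : Submodule F (Ambient F m n)) : Prop :=
  IsGreatest {w : ℕ | ∃ C ∈ A, weightedRank C = w} (Module.finrank F A)

/-- The trace form `Tr(D, C) = ∑ i, tr(D_i C_iᵗ)`. -/
def traceForm (D C : Ambient F m n) : F :=
  ∑ i, (D i * (C i).transpose).trace

/-- The dual code: all `D` such that `Tr(D, C) = 0` for every `C` in the code. -/
def dual (A : Submodule F (Ambient F m n)) : Submodule F (Ambient F m n) where
  carrier := {D | ∀ C ∈ A, traceForm D C = 0}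
  zero_mem' := by
    intro C _
    simp [traceForm]
  add_mem' := by
    intro D E hD hE C hC
    have h1 := hD C hC
    have h2 := hE C hC
    simp only [traceForm] at h1 h2 ⊢
    simp [Matrix.add_mul, Finset.sum_add_distrib, h1, h2]
  smul_mem' := by
    intro c D hD C hC
    have h1 := hD C hC
    simp only [traceForm] at h1 ⊢
    simp [← Finset.mul_sum, h1]

end SumRank

/-! ### Anticode bound for a coset of matrices in one block. -/

namespace SumRank

set_option linter.unusedSectionVars false

open Module

/-! Every code has a word whose weight is at least its dimension, so optimality means that no word
has weight above the dimension (`IsBounded`). The one-block bound holds in every coset `c + A`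
(`exists_finrank_le_mul_rank`), so blocks can be split off one at a time: the dimension of a code is
that of its component in block `a` plus that of its projection away from `a`.

The heart is that a bounded code is the product of its components (`IsBounded.isProduct`). A block
entry in the wrong coset of the component would allow a rank jump, which costs `m a`. If `m a ≥ 2`,
this is too much even for words whose remaining weight is one short of maximal, and differences of
such words detect a whole product code. If `m a = 1`, only words of maximal weight can be used; they
suffice over fields with a third element, or when at most two blocks have `m i = 1`. The binary
even-weight code of length 3, whose dual is the repetition code, shows the obstruction.

Each component then has dimension `m i * r` and ranks at most `r`. A matrix `D` orthogonal to it
satisfies `D.rank + r ≤ n i` (`rank_add_le_of_trace_eq_zero`): otherwise some Gabidulin code of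
minimum rank above `r` is a complement of the component and also orthogonal to `D`, which forces `D
= 0`. Summing over blocks bounds the weights in the dual, and biduality gives the converse. -/

theorem exists_injective_of_sum_gt {m r : ℕ} (d : Fin m → ℕ) (hd : ∀ i, d i ≤ m)
    (hs : m * r < ∑ i, d i) :
    ∃ σ : Fin (r + 1) → Fin m, Function.Injective σ ∧ ∀ t : Fin (r + 1), (t : ℕ) + 1 ≤ d (σ t) := by
  classical
  -- If at most `j` of the values exceed `r - j`, then for `r ≤ m` the sum is at most `j * m + (m -
  -- j) * (r - j) ≤ m * r`. For `r > m` the trivial bound `m * m` is enough.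
  have hcount : ∀ j ≤ r, j < (Finset.univ.filter fun i => r + 1 - j ≤ d i).card := by
    intro j hj
    by_contra hcon
    push Not at hcon
    set S := Finset.univ.filter fun i => r + 1 - j ≤ d i with hS
    have h1 : ∑ i, d i ≤ S.card * m + (m - S.card) * (r - j) := by
      rw [← Finset.sum_add_sum_compl S]
      have hc : Sᶜ.card = m - S.card := by simp [Finset.card_compl]
      rw [← hc]
      gcongr
      · exact Finset.sum_le_card_nsmul _ _ _ fun i _ => hd i
      · refine Finset.sum_le_card_nsmul _ _ _ fun i hi => ?_
        simp only [hS, Finset.mem_compl, Finset.mem_filter, Finset.mem_univ, true_and] at hi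
        omega
    have hSm : S.card ≤ m := by simpa using Finset.card_le_univ S
    by_cases hrm : r ≤ m
    · obtain ⟨a, ha⟩ := Nat.exists_eq_add_of_le hSm
      obtain ⟨b, rfl⟩ := Nat.exists_eq_add_of_le hj
      obtain ⟨c, hc⟩ := Nat.exists_eq_add_of_le hcon
      simp only [Nat.add_sub_cancel_left] at h1
      have h2 : m - S.card = a := by omega
      rw [h2] at h1
      have h3 : S.card * m + a * b ≤ m * (j + b) := by
        have : S.card ≤ j := hcon
        have h4 : j + b ≤ m := hrm
        nlinarith [Nat.zero_le (S.card * c), Nat.zero_le c]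
      omega
    · have h2 : ∑ i, d i ≤ m * m := by
        simpa using Finset.sum_le_card_nsmul Finset.univ d m fun i _ => hd i
      have : m * m ≤ m * r := Nat.mul_le_mul_left _ (by omega)
      omega
  -- Greedy choice from the most demanding position `r` downwards: position `r - k` has more than
  -- `k` admissible indices, and only `k` are taken.
  have key : ∀ k ≤ r + 1, ∃ σ : Fin (r + 1) → Fin m,
      Set.InjOn σ {t : Fin (r + 1) | r + 1 - k ≤ (t : ℕ)} ∧
        ∀ t : Fin (r + 1), r + 1 - k ≤ (t : ℕ) → (t : ℕ) + 1 ≤ d (σ t) := by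
    intro k
    induction k with
    | zero =>
      intro _
      have := hcount 0 (Nat.zero_le _)
      obtain ⟨i, _⟩ := Finset.card_pos.mp this
      refine ⟨fun _ => i, ?_, ?_⟩
      · intro t ht
        have := t.2
        simp at ht
        omega
      · intro t ht
        have := t.2
        omega
    | succ k ih =>
      intro hk
      obtain ⟨σ, hinj, hσ⟩ := ih (by omega)
      have hlt : ((Finset.univ.filter fun t : Fin (r + 1) => r + 1 - k ≤ (t : ℕ)).image σ).card <
          (Finset.univ.filter fun i => r + 1 - k ≤ d i).card := by
        refine lt_of_le_of_lt ?_ (hcount k (by omega))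
        refine Finset.card_image_le.trans ?_
        have : (Finset.univ.filter fun t : Fin (r + 1) => r + 1 - k ≤ (t : ℕ)) ⊆
            Finset.univ.filter fun t : Fin (r + 1) => (t.rev : ℕ) < k := by
          intro t ht
          have := t.2
          simp [Fin.val_rev] at ht ⊢
          omega
        refine (Finset.card_le_card this).trans ?_
        have h5 := Finset.card_le_card_of_injOn (s := Finset.univ.filter
          fun t : Fin (r + 1) => (t.rev : ℕ) < k) (t := Finset.range k)
          (fun t => (t.rev : ℕ)) (by intro t ht; simpa using ht)
          (by intro a _ b _ hab; exact Fin.rev_injective (Fin.ext hab))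
        simpa using h5
      obtain ⟨i, hi, hni⟩ := Finset.exists_mem_notMem_of_card_lt_card hlt
      simp only [Finset.mem_filter, Finset.mem_univ, true_and, Finset.mem_image, not_exists,
        not_and] at hi hni
      let t₀ : Fin (r + 1) := ⟨r - k, by omega⟩
      refine ⟨Function.update σ t₀ i, ?_, ?_⟩
      · intro a ha b hb hab
        simp only [Set.mem_ofPred_eq] at ha hb
        by_cases h1 : a = t₀ <;> by_cases h2 : b = t₀
        · rw [h1, h2]
        · subst h1
          rw [Function.update_self, Function.update_of_ne h2] at hab
          have : (b : ℕ) ≠ r - k := fun h => h2 (Fin.ext h)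
          exact absurd hab.symm (hni b (by omega))
        · subst h2
          rw [Function.update_self, Function.update_of_ne h1] at hab
          have : (a : ℕ) ≠ r - k := fun h => h1 (Fin.ext h)
          exact absurd hab (hni a (by omega))
        · rw [Function.update_of_ne h1, Function.update_of_ne h2] at hab
          have h3 : (a : ℕ) ≠ r - k := fun h => h1 (Fin.ext h)
          have h4 : (b : ℕ) ≠ r - k := fun h => h2 (Fin.ext h)
          exact hinj (by simp only [Set.mem_ofPred_eq]; omega)
            (by simp only [Set.mem_ofPred_eq]; omega) hab
      · intro t ht
        by_cases h1 : t = t₀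
        · subst h1
          rw [Function.update_self]
          simp only [t₀]
          omega
        · rw [Function.update_of_ne h1]
          have h3 : (t : ℕ) ≠ r - k := fun h => h1 (Fin.ext h)
          exact hσ t (by omega)
  obtain ⟨σ, h1, h2⟩ := key (r + 1) le_rfl
  refine ⟨σ, fun a b hab => h1 (by simp) (by simp) hab, fun t => h2 t (by simp)⟩

variable {F : Type*} [Field F]

theorem exists_linearIndependent_of_finrank_gt {W : Type*} [AddCommGroup W] [Module F W]
    [FiniteDimensional F W] {k : ℕ} (V : Fin k → Submodule F W)
    (h : ∀ t : Fin k, (t : ℕ) + 1 ≤ finrank F (V t)) :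
    ∃ v : Fin k → W, (∀ t, v t ∈ V t) ∧ LinearIndependent F v := by
  induction k with
  | zero => exact ⟨fun t => t.elim0, fun t => t.elim0, linearIndependent_empty_type⟩
  | succ k ih =>
    obtain ⟨v, hv, hli⟩ := ih (fun t => V t.castSucc) (fun t => by simpa using h t.castSucc)
    have hlt : ¬ V (Fin.last k) ≤ Submodule.span F (Set.range v) := by
      intro hle
      have h1 := Submodule.finrank_mono hle
      have h2 := finrank_range_le_card (R := F) v
      have h3 := h (Fin.last k)
      simp [Set.finrank] at h1 h2 h3
      omega
    obtain ⟨x, hx, hxn⟩ := SetLike.not_le_iff_exists.mp hlt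
    refine ⟨Fin.snoc (α := fun _ => W) v x, fun t => ?_, linearIndependent_finSnoc.mpr ⟨hli, hxn⟩⟩
    refine Fin.lastCases ?_ (fun t => ?_) t
    · simpa using hx
    · simpa using hv t

variable {m n : ℕ}

/-- The matrices of `A` whose first `k` rows vanish. -/
def rowFlag (A : Submodule F (Matrix (Fin m) (Fin n) F)) (k : ℕ) :
    Submodule F (Matrix (Fin m) (Fin n) F) where
  carrier := {X | X ∈ A ∧ ∀ j : Fin m, (j : ℕ) < k → X j = 0}
  zero_mem' := ⟨A.zero_mem, fun _ _ => rfl⟩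
  add_mem' := by
    rintro X Y ⟨hX, hX'⟩ ⟨hY, hY'⟩
    refine ⟨A.add_mem hX hY, fun j hj => ?_⟩
    have : (X + Y) j = X j + Y j := rfl
    rw [this, hX' j hj, hY' j hj, add_zero]
  smul_mem' := by
    rintro c X ⟨hX, hX'⟩
    refine ⟨A.smul_mem c hX, fun j hj => ?_⟩
    have : (c • X) j = c • X j := rfl
    rw [this, hX' j hj, smul_zero]

theorem mem_rowFlag {A : Submodule F (Matrix (Fin m) (Fin n) F)} {k : ℕ}
    {X : Matrix (Fin m) (Fin n) F} :
    X ∈ rowFlag A k ↔ X ∈ A ∧ ∀ j : Fin m, (j : ℕ) < k → X j = 0 := Iff.rfl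

/-- The map that takes a matrix to its row with index `i`. -/
def rowMap (i : Fin m) : Matrix (Fin m) (Fin n) F →ₗ[F] (Fin n → F) where
  toFun X := X i
  map_add' _ _ := rfl
  map_smul' _ _ := rfl

/-- Rank-nullity for the row map on the flag: its kernel is the next flag step. -/
theorem finrank_rowFlag (A : Submodule F (Matrix (Fin m) (Fin n) F)) (i : Fin m) :
    finrank F ((rowFlag A i).map (rowMap i)) + finrank F (rowFlag A (i + 1)) =
      finrank F (rowFlag A i) := by
  have h := LinearMap.finrank_range_add_finrank_ker ((rowMap i).domRestrict (rowFlag A i))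
  rw [LinearMap.range_domRestrict] at h
  rw [← h]
  congr 1
  rw [← LinearMap.finrank_range_of_inj (f := (rowFlag A i).subtype ∘ₗ
    (LinearMap.ker ((rowMap i).domRestrict (rowFlag A i))).subtype)
    (Subtype.val_injective.comp Subtype.val_injective)]
  congr 2
  all_goals
    try rw [LinearMap.range_comp, Submodule.range_subtype]
  all_goals
    ext X
    simp only [mem_rowFlag, Submodule.mem_map, LinearMap.mem_ker]
    constructor
    · rintro ⟨hX, hX'⟩
      exact ⟨⟨X, hX, fun j hj => hX' j (by omega)⟩, hX' i (by omega), rfl⟩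
    · rintro ⟨⟨Y, hY, hY'⟩, h0, rfl⟩
      refine ⟨hY, fun j hj => ?_⟩
      rcases Nat.lt_succ_iff_lt_or_eq.mp hj with h | h
      · exact hY' j h
      · rw [Fin.ext h]; exact h0

theorem sum_finrank_rowFlag (A : Submodule F (Matrix (Fin m) (Fin n) F)) :
    ∑ i : Fin m, finrank F ((rowFlag A i).map (rowMap i)) = finrank F A := by
  have h0 : rowFlag A 0 = A := by ext; simp [mem_rowFlag]
  have hm : rowFlag A m = ⊥ := by
    rw [eq_bot_iff]
    rintro X ⟨_, hX⟩
    exact funext fun j => hX j j.2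
  have h : ∀ i : Fin m, (finrank F ((rowFlag A i).map (rowMap i)) : ℤ) =
      (fun k : ℕ => (finrank F (rowFlag A k) : ℤ) - finrank F (rowFlag A (k + 1))) i := by
    intro i
    have := finrank_rowFlag A i
    simp only
    omega
  zify
  rw [Finset.sum_congr rfl fun i _ => h i,
    Fin.sum_univ_eq_sum_range (fun k : ℕ => (finrank F (rowFlag A k) : ℤ) -
      finrank F (rowFlag A (k + 1))) m, Finset.sum_range_sub', h0, hm]
  simp

/-- The spaces of leading rows have dimensions at most `n ≤ m` that add up to `finrank F A`. The
counting lemma picks rows where these dimensions grow fast enough for a greedy independent choice.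
-/
theorem exists_row_transversal (hnm : n ≤ m) (A : Submodule F (Matrix (Fin m) (Fin n) F)) {r : ℕ}
    (h : m * r < finrank F A) :
    ∃ (σ : Fin (r + 1) → Fin m) (x : Fin (r + 1) → Matrix (Fin m) (Fin n) F),
      Function.Injective σ ∧ (∀ t, x t ∈ rowFlag A (σ t)) ∧
        LinearIndependent F fun t => x t (σ t) := by
  have hd : ∀ i : Fin m, finrank F ((rowFlag A i).map (rowMap i)) ≤ m := by
    intro i
    have := Submodule.finrank_le ((rowFlag A i).map (rowMap i))
    rw [finrank_fin_fun] at this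
    exact this.trans hnm
  have hs := sum_finrank_rowFlag A
  generalize hdd : (fun i : Fin m => finrank F ((rowFlag A i).map (rowMap i))) = d
  have hd' : ∀ i : Fin m, finrank F ((rowFlag A i).map (rowMap i)) = d i := fun i => by rw [← hdd]
  simp only [hd'] at hd hs
  obtain ⟨σ, hσ, hd⟩ := exists_injective_of_sum_gt d hd (by rwa [hs])
  obtain ⟨v, hv, hli⟩ := exists_linearIndependent_of_finrank_gt
    (fun t => (rowFlag A (σ t)).map (rowMap (σ t))) (fun t => by rw [hd']; exact hd t)
  have hx : ∀ t, ∃ x ∈ rowFlag A (σ t), x (σ t) = v t := hv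
  choose x hx hxv using hx
  refine ⟨σ, x, hσ, hx, ?_⟩
  simp only [hxv]
  exact hli

/-- Take `f` vanishing on all the other vectors. This turns "stay independent" into one nonvanishing
condition. -/
theorem exists_functional_update {W : Type*} [AddCommGroup W] [Module F W] {ι : Type*}
    [DecidableEq ι] {u : ι → W} (hu : LinearIndependent F u) (t₀ : ι) :
    ∃ f : W →ₗ[F] F, f (u t₀) ≠ 0 ∧
      ∀ w, f w ≠ 0 → LinearIndependent F (Function.update u t₀ w) := by
  have hn : u t₀ ∉ Submodule.span F (u '' {t₀}ᶜ) :=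
    linearIndependent_iff_notMem_span.mp hu t₀ |> fun h => by
      rwa [Set.compl_eq_univ_sdiff]
  obtain ⟨f, hf, hle⟩ := Submodule.exists_le_ker_of_notMem hn
  refine ⟨f, hf, fun w hw => ?_⟩
  have h0 : ∀ t, t ≠ t₀ → f (u t) = 0 := fun t ht =>
    hle (Submodule.subset_span ⟨t, ht, rfl⟩)
  rw [linearIndependent_iff'] at hu ⊢
  intro s g hg i hi
  have hft : ∀ t, f (Function.update u t₀ w t) = if t = t₀ then f w else 0 := by
    intro t
    by_cases h : t = t₀
    · subst h; simp
    · simp [h, h0 t h]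
  have hg0 : t₀ ∈ s → g t₀ = 0 := by
    intro hts
    have := congrArg f hg
    simp only [map_sum, map_smul, hft, smul_eq_mul, mul_ite, mul_zero, map_zero] at this
    rw [Finset.sum_ite_eq' s t₀] at this
    simpa [hts, hw] using this
  by_cases hit : i = t₀
  · rw [hit]; exact hg0 (hit ▸ hi)
  · refine hu s (fun t => if t = t₀ then 0 else g t) ?_ i hi |> fun h => by simpa [hit] using h
    rw [← hg]
    refine Finset.sum_congr rfl fun t ht => ?_
    by_cases h : t = t₀
    · subst h; simp [hg0 ht]
    · simp [h]

theorem rank_ge_of_linearIndependent_rows {r : ℕ} {σ : Fin r → Fin m}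
    {M : Matrix (Fin m) (Fin n) F} (h : LinearIndependent F fun t => M (σ t)) : r ≤ M.rank := by
  rw [M.rank_eq_finrank_span_row]
  have := linearIndependent_iff_card_eq_finrank_span.mp h
  rw [Fintype.card_fin] at this
  rw [this]
  refine Submodule.finrank_mono (Submodule.span_mono ?_)
  rintro _ ⟨t, rfl⟩
  exact ⟨σ t, rfl⟩

/-- Rows chosen from a matrix below the threshold `k`, and from `x` from there on. -/
def mixedRows {r : ℕ} (σ : Fin r → Fin m) (x : Fin r → Matrix (Fin m) (Fin n) F)
    (M : Matrix (Fin m) (Fin n) F) (k : ℕ) (t : Fin r) : Fin n → F :=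
  if (σ t : ℕ) < k then M (σ t) else x t (σ t)

theorem mixedRows_succ_of_ne {r : ℕ} {σ : Fin r → Fin m} {x : Fin r → Matrix (Fin m) (Fin n) F}
    (M : Matrix (Fin m) (Fin n) F) {k : ℕ} (h : ∀ t, (σ t : ℕ) ≠ k) :
    mixedRows σ x M (k + 1) = mixedRows σ x M k := by
  funext t
  have := h t
  simp only [mixedRows]
  congr 1
  simp only [eq_iff_iff]
  omega

theorem mixedRows_add {r : ℕ} {σ : Fin r → Fin m} {x : Fin r → Matrix (Fin m) (Fin n) F}
    (M Y : Matrix (Fin m) (Fin n) F) {k : ℕ} (hY : ∀ j : Fin m, (j : ℕ) < k → Y j = 0) :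
    mixedRows σ x (M + Y) k = mixedRows σ x M k := by
  funext t
  simp only [mixedRows]
  split_ifs with h
  · have : (M + Y) (σ t) = M (σ t) + Y (σ t) := rfl
    rw [this, hY _ h, add_zero]
  · rfl

theorem mixedRows_succ {r : ℕ} {σ : Fin r → Fin m} (hσ : Function.Injective σ)
    {x : Fin r → Matrix (Fin m) (Fin n) F} (M : Matrix (Fin m) (Fin n) F) (t : Fin r) :
    mixedRows σ x M (σ t + 1) = Function.update (mixedRows σ x M (σ t)) t (M (σ t)) := by
  funext s
  by_cases h : s = t
  · subst h; simp [mixedRows]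
  · have : (σ s : ℕ) ≠ σ t := fun hh => h (hσ (Fin.ext hh))
    rw [Function.update_of_ne h]
    simp only [mixedRows]
    congr 1
    simp only [eq_iff_iff]
    omega

/-- Adding an element of the `k`-th flag step leaves the rows before `k` alone. If row `k` of `M`
fails the nonvanishing test, adding `x t` repairs it. -/
theorem exists_mixedRows_step {r : ℕ} {A : Submodule F (Matrix (Fin m) (Fin n) F)}
    {σ : Fin r → Fin m} (hσ : Function.Injective σ) {x : Fin r → Matrix (Fin m) (Fin n) F}
    (hx : ∀ t, x t ∈ rowFlag A (σ t)) {M : Matrix (Fin m) (Fin n) F} {k : ℕ}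
    (hM : LinearIndependent F (mixedRows σ x M k)) :
    ∃ Y ∈ rowFlag A k, LinearIndependent F (mixedRows σ x (M + Y) (k + 1)) := by
  by_cases hk : ∃ t, (σ t : ℕ) = k
  · obtain ⟨t, rfl⟩ := hk
    obtain ⟨f, hf, hup⟩ := exists_functional_update hM t
    have hxt : mixedRows σ x M (σ t) t = x t (σ t) := by simp [mixedRows]
    rw [hxt] at hf
    by_cases h0 : f (M (σ t)) = 0
    · refine ⟨x t, hx t, ?_⟩
      rw [mixedRows_succ hσ, mixedRows_add _ _ (hx t).2]
      refine hup _ ?_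
      have : (M + x t) (σ t) = M (σ t) + x t (σ t) := rfl
      rwa [this, map_add, h0, zero_add]
    · refine ⟨0, Submodule.zero_mem _, ?_⟩
      rw [add_zero, mixedRows_succ hσ]
      exact hup _ h0
  · push Not at hk
    refine ⟨0, Submodule.zero_mem _, ?_⟩
    rw [add_zero, mixedRows_succ_of_ne M hk]
    exact hM

theorem mixedRows_zero {r : ℕ} (σ : Fin r → Fin m) (x : Fin r → Matrix (Fin m) (Fin n) F)
    (M : Matrix (Fin m) (Fin n) F) : mixedRows σ x M 0 = fun t => x t (σ t) := by
  funext t; simp [mixedRows]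

theorem mixedRows_top {r : ℕ} (σ : Fin r → Fin m) (x : Fin r → Matrix (Fin m) (Fin n) F)
    (M : Matrix (Fin m) (Fin n) F) : mixedRows σ x M m = fun t => M (σ t) := by
  funext t; simp [mixedRows]

theorem exists_rank_gt_of_lt_finrank (hnm : n ≤ m) (A : Submodule F (Matrix (Fin m) (Fin n) F))
    (c : Matrix (Fin m) (Fin n) F) {r : ℕ} (h : m * r < finrank F A) :
    ∃ X ∈ A, r < (c + X).rank := by
  obtain ⟨σ, x, hσ, hx, hli⟩ := exists_row_transversal hnm A h
  -- The sweep starts with the rows of `x`, which do not involve `c`, and ends with rows of `c + X`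
  -- itself; hence the bound holds in every coset.
  have key : ∀ k : ℕ, ∃ X ∈ A, LinearIndependent F (mixedRows σ x (c + X) k) := by
    intro k
    induction k with
    | zero => exact ⟨0, A.zero_mem, by rwa [mixedRows_zero]⟩
    | succ k ih =>
      obtain ⟨X, hX, hi⟩ := ih
      obtain ⟨Y, hY, hi'⟩ := exists_mixedRows_step hσ hx hi
      exact ⟨X + Y, A.add_mem hX hY.1, by rwa [← add_assoc]⟩
  obtain ⟨X, hX, hi⟩ := key m
  rw [mixedRows_top] at hi
  exact ⟨X, hX, rank_ge_of_linearIndependent_rows hi⟩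

/-- Affine anticode bound for one block. -/
theorem exists_finrank_le_mul_rank (hnm : n ≤ m) (A : Submodule F (Matrix (Fin m) (Fin n) F))
    (c : Matrix (Fin m) (Fin n) F) : ∃ X ∈ A, finrank F A ≤ m * (c + X).rank := by
  by_contra! hcon
  have key : ∀ r : ℕ, ∃ X ∈ A, r ≤ (c + X).rank := by
    intro r
    induction r with
    | zero => exact ⟨0, A.zero_mem, Nat.zero_le _⟩
    | succ r ih =>
      obtain ⟨X, hX, hr⟩ := ih
      exact exists_rank_gt_of_lt_finrank hnm A c
        (lt_of_le_of_lt (Nat.mul_le_mul_left _ hr) (hcon X hX))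
  obtain ⟨X, _, hX⟩ := key (n + 1)
  have := (c + X).rank_le_width
  omega

end SumRank

/-! ### Larger ranks in a nontrivial coset over a field with a third element. -/

namespace SumRank

open Module

variable {F : Type*} [Field F] {m n : ℕ}

/-- On a line where neither `f` nor `g` vanishes identically, each condition excludes one scalar,
and a third scalar remains. -/
theorem exists_avoid_two {U : Type*} [AddCommGroup U] [Module F U]
    (hF : ∃ b : F, b ≠ 0 ∧ b ≠ 1) (S : Submodule F U) (f g : U →ₗ[F] F) {y z : U}
    (hy : y ∈ S) (hz : z ∈ S) (hfy : f y ≠ 0) (hgz : g z ≠ 0) (a b : F) :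
    ∃ x ∈ S, a + f x ≠ 0 ∧ b + g x ≠ 0 := by
  obtain ⟨w, hw, hfw, hgw⟩ : ∃ w ∈ S, f w ≠ 0 ∧ g w ≠ 0 := by
    by_cases h1 : g y = 0
    · by_cases h2 : f z = 0
      · exact ⟨y + z, S.add_mem hy hz, by simpa [h2], by simpa [h1]⟩
      · exact ⟨z, hz, h2, hgz⟩
    · exact ⟨y, hy, hfy, h1⟩
  have key : ∃ t : F, t ≠ -a / f w ∧ t ≠ -b / g w := by
    obtain ⟨e, he0, he1⟩ := hF
    by_contra! hcon
    by_cases h : (-a / f w) = 0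
    · have h1 := hcon 1 (by rw [h]; exact one_ne_zero)
      have h2 := hcon e (by rw [h]; exact he0)
      exact he1 (h2.trans h1.symm)
    · have h0 := hcon 0 (Ne.symm h)
      by_cases h1 : (-a / f w) = 1
      · exact he0 ((hcon e (by rw [h1]; exact he1)).trans h0.symm)
      · exact one_ne_zero ((hcon 1 (Ne.symm h1)).trans h0.symm)
  obtain ⟨t, ht1, ht2⟩ := key
  refine ⟨t • w, S.smul_mem t hw, fun h => ht1 ?_, fun h => ht2 ?_⟩
  · rw [map_smul, smul_eq_mul] at h
    rw [eq_div_iff hfw]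
    linear_combination h
  · rw [map_smul, smul_eq_mul] at h
    rw [eq_div_iff hgw]
    linear_combination h

theorem exists_mixedRows_step_avoid (hF : ∃ b : F, b ≠ 0 ∧ b ≠ 1) {r : ℕ}
    {A : Submodule F (Matrix (Fin m) (Fin n) F)}
    {σ : Fin r → Fin m} (hσ : Function.Injective σ) {x : Fin r → Matrix (Fin m) (Fin n) F}
    (hx : ∀ t, x t ∈ rowFlag A (σ t)) {M : Matrix (Fin m) (Fin n) F} {k : ℕ}
    (hM : LinearIndependent F (mixedRows σ x M k)) (g : Matrix (Fin m) (Fin n) F →ₗ[F] F)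
    {y : Matrix (Fin m) (Fin n) F} (hy : y ∈ rowFlag A k) (hg : g y ≠ 0) :
    ∃ Y ∈ rowFlag A k, LinearIndependent F (mixedRows σ x (M + Y) (k + 1)) ∧ g (M + Y) ≠ 0 := by
  by_cases hk : ∃ t, (σ t : ℕ) = k
  · obtain ⟨t, rfl⟩ := hk
    obtain ⟨f, hf, hup⟩ := exists_functional_update hM t
    have hxt : mixedRows σ x M (σ t) t = x t (σ t) := by simp [mixedRows]
    rw [hxt] at hf
    obtain ⟨Y, hY, h1, h2⟩ := exists_avoid_two hF (rowFlag A (σ t)) (f ∘ₗ rowMap (σ t)) g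
      (hx t) hy hf hg (f (M (σ t))) (g M)
    refine ⟨Y, hY, ?_, by rwa [map_add]⟩
    rw [mixedRows_succ hσ, mixedRows_add _ _ hY.2]
    refine hup _ ?_
    have : (M + Y) (σ t) = M (σ t) + Y (σ t) := rfl
    rwa [this, map_add]
  · push Not at hk
    have h : ∀ Y ∈ rowFlag A k, LinearIndependent F (mixedRows σ x (M + Y) (k + 1)) := by
      intro Y hY
      rw [mixedRows_succ_of_ne _ hk, mixedRows_add _ _ hY.2]
      exact hM
    by_cases h0 : g M = 0
    · exact ⟨y, hy, h y hy, by rwa [map_add, h0, zero_add]⟩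
    · exact ⟨0, Submodule.zero_mem _, h 0 (Submodule.zero_mem _), by rwa [add_zero]⟩

theorem rank_smul_of_ne_zero {a : F} (ha : a ≠ 0) (M : Matrix (Fin m) (Fin n) F) :
    (a • M).rank = M.rank := by
  have h : a • M = (a • (1 : Matrix (Fin m) (Fin m) F)) * M := by simp
  rw [h]
  refine Matrix.rank_mul_eq_right_of_isUnit_det _ _ ?_
  rw [Matrix.det_smul, Matrix.det_one, mul_one]
  exact (IsUnit.mk0 a ha).pow _

/-- Adjoining `c` raises the dimension above `m * r`, so the span contains a matrix of rank above
`r`. Steering the row sweep so that this matrix has a nonzero coefficient at `c` allows rescaling it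
into `c + A`. -/
theorem exists_rank_gt_of_notMem (hF : ∃ b : F, b ≠ 0 ∧ b ≠ 1) (hnm : n ≤ m)
    {A : Submodule F (Matrix (Fin m) (Fin n) F)} {c : Matrix (Fin m) (Fin n) F} (hc : c ∉ A)
    {r : ℕ} (h : m * r ≤ finrank F A) : ∃ X ∈ A, r < (c + X).rank := by
  obtain ⟨g, hgc, hgA⟩ := Submodule.exists_le_ker_of_notMem hc
  set V := A ⊔ Submodule.span F {c} with hV
  have hlt : m * r < finrank F V := by
    refine lt_of_le_of_lt h (Submodule.finrank_lt_finrank_of_lt (lt_of_le_of_ne le_sup_left ?_))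
    intro he
    exact hc (he ▸ (le_sup_right : _ ≤ V) (Submodule.mem_span_singleton_self c))
  obtain ⟨σ, x, hσ, hx, hli⟩ := exists_row_transversal hnm V hlt
  have hex : ∃ k, ¬ ∃ y ∈ rowFlag V k, g y ≠ 0 := by
    refine ⟨m, ?_⟩
    rintro ⟨y, hy, hgy⟩
    have : y = 0 := funext fun j => hy.2 j j.2
    exact hgy (by rw [this, map_zero])
  classical
  -- `k₀` is the last flag step on which `g` is not identically zero. The value of `g` is made
  -- nonzero there, and later corrections cannot change it.
  obtain ⟨k₀, hk₀⟩ : ∃ k₀, Nat.find hex = k₀ + 1 := by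
    refine Nat.exists_eq_succ_of_ne_zero fun h0 => ?_
    have := Nat.find_spec hex
    rw [h0] at this
    exact this ⟨c, ⟨(le_sup_right : _ ≤ V) (Submodule.mem_span_singleton_self c),
      fun j hj => absurd hj (Nat.not_lt_zero _)⟩, hgc⟩
  have hlast : ∀ y ∈ rowFlag V (k₀ + 1), g y = 0 := by
    intro y hy
    have := Nat.find_spec hex
    rw [hk₀] at this
    by_contra hne
    exact this ⟨y, hy, hne⟩
  obtain ⟨y₀, hy₀, hgy₀⟩ : ∃ y ∈ rowFlag V k₀, g y ≠ 0 := by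
    have := Nat.find_min hex (m := k₀) (by omega)
    exact not_not.mp this
  have key : ∀ k : ℕ, ∃ X ∈ V, LinearIndependent F (mixedRows σ x X k) ∧ (k₀ < k → g X ≠ 0) := by
    intro k
    induction k with
    | zero => exact ⟨0, V.zero_mem, by rwa [mixedRows_zero], fun h => absurd h (Nat.not_lt_zero _)⟩
    | succ k ih =>
      obtain ⟨X, hX, hi, hgX⟩ := ih
      rcases eq_or_ne k k₀ with rfl | hne
      · obtain ⟨Y, hY, h1, h2⟩ := exists_mixedRows_step_avoid hF hσ hx hi g hy₀ hgy₀
        exact ⟨X + Y, V.add_mem hX hY.1, h1, fun _ => h2⟩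
      · obtain ⟨Y, hY, h1⟩ := exists_mixedRows_step hσ hx hi
        refine ⟨X + Y, V.add_mem hX hY.1, h1, fun hk => ?_⟩
        rw [map_add, hlast Y ⟨hY.1, fun j hj => hY.2 j (by omega)⟩, add_zero]
        exact hgX (by omega)
  -- Past `m` every selected row belongs to `X`; past `k₀` the condition on `g` is available.
  obtain ⟨X, hX, hi, hgX⟩ := key (max m (k₀ + 1))
  have htop : mixedRows σ x X (max m (k₀ + 1)) = fun t => X (σ t) := by
    funext t
    have := (σ t).2
    simp only [mixedRows]
    rw [if_pos (by omega)]
  rw [htop] at hi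
  have hr := rank_ge_of_linearIndependent_rows hi
  obtain ⟨Y, hY, Z, hZ, rfl⟩ := Submodule.mem_sup.mp hX
  obtain ⟨a, rfl⟩ := Submodule.mem_span_singleton.mp hZ
  have ha : a ≠ 0 := by
    rintro rfl
    refine hgX (by omega) ?_
    rw [zero_smul, add_zero]
    exact hgA hY
  refine ⟨a⁻¹ • Y, A.smul_mem _ hY, ?_⟩
  rw [← rank_smul_of_ne_zero ha, smul_add, smul_inv_smul₀ ha, add_comm]
  exact hr

end SumRank

/-! ### Splitting off one block. -/

namespace SumRank

open Module

variable {F : Type*} [Field F] {ℓ : ℕ} {m n : Fin ℓ → ℕ}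

/-- The embedding of a block into the ambient space. -/
def blockSingle (F : Type*) [Field F] {ℓ : ℕ} (m n : Fin ℓ → ℕ) (a : Fin ℓ) :
    Matrix (Fin (m a)) (Fin (n a)) F →ₗ[F] Ambient F m n :=
  LinearMap.single F (fun i => Matrix (Fin (m i)) (Fin (n i)) F) a

/-- The map that replaces the block with index `a` by zero. -/
def eraseBlock (F : Type*) [Field F] {ℓ : ℕ} (m n : Fin ℓ → ℕ) (a : Fin ℓ) :
    Ambient F m n →ₗ[F] Ambient F m n :=
  LinearMap.id - blockSingle F m n a ∘ₗ LinearMap.proj a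

/-- The matrices that give an element of `A` when put into block `a`. -/
def component (A : Submodule F (Ambient F m n)) (a : Fin ℓ) :
    Submodule F (Matrix (Fin (m a)) (Fin (n a)) F) :=
  A.comap (blockSingle F m n a)

/-- The weight of every element is at most the dimension. -/
def IsBounded (A : Submodule F (Ambient F m n)) : Prop :=
  ∀ C ∈ A, weightedRank C ≤ finrank F A

/-- The code is the product of its components. -/
def IsProduct (A : Submodule F (Ambient F m n)) : Prop :=
  ∀ C ∈ A, ∀ i, blockSingle F m n i (C i) ∈ A

@[simp] theorem blockSingle_self (a : Fin ℓ) (X : Matrix (Fin (m a)) (Fin (n a)) F) :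
    blockSingle F m n a X a = X := Pi.single_eq_same _ _

theorem blockSingle_of_ne {a i : Fin ℓ} (h : i ≠ a) (X : Matrix (Fin (m a)) (Fin (n a)) F) :
    blockSingle F m n a X i = 0 := Pi.single_eq_of_ne h _

theorem eraseBlock_apply (a : Fin ℓ) (C : Ambient F m n) :
    eraseBlock F m n a C = C - blockSingle F m n a (C a) := rfl

theorem eraseBlock_self (a : Fin ℓ) (C : Ambient F m n) : eraseBlock F m n a C a = 0 := by
  rw [eraseBlock_apply, Pi.sub_apply, blockSingle_self, sub_self]

theorem eraseBlock_of_ne {a i : Fin ℓ} (h : i ≠ a) (C : Ambient F m n) :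
    eraseBlock F m n a C i = C i := by
  rw [eraseBlock_apply, Pi.sub_apply, blockSingle_of_ne h, sub_zero]

theorem eraseBlock_blockSingle (a : Fin ℓ) (X : Matrix (Fin (m a)) (Fin (n a)) F) :
    eraseBlock F m n a (blockSingle F m n a X) = 0 := by
  rw [eraseBlock_apply, blockSingle_self, sub_self]

theorem eraseBlock_add_blockSingle (a : Fin ℓ) (C : Ambient F m n) :
    eraseBlock F m n a C + blockSingle F m n a (C a) = C := by
  rw [eraseBlock_apply, sub_add_cancel]

theorem weightedRank_zero : weightedRank (0 : Ambient F m n) = 0 := by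
  simp [weightedRank]

theorem weightedRank_eq_add (a : Fin ℓ) (C : Ambient F m n) :
    weightedRank C = m a * (C a).rank + weightedRank (eraseBlock F m n a C) := by
  classical
  simp only [weightedRank]
  rw [← Finset.add_sum_erase _ _ (Finset.mem_univ a),
    ← Finset.add_sum_erase _ (fun i => m i * (eraseBlock F m n a C i).rank) (Finset.mem_univ a),
    eraseBlock_self, Matrix.rank_zero, mul_zero, zero_add]
  congr 1
  refine Finset.sum_congr rfl fun i hi => ?_
  rw [eraseBlock_of_ne (Finset.ne_of_mem_erase hi)]

theorem weightedRank_add_blockSingle (a : Fin ℓ) (C : Ambient F m n)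
    (X : Matrix (Fin (m a)) (Fin (n a)) F) :
    weightedRank (C + blockSingle F m n a X) =
      m a * (C a + X).rank + weightedRank (eraseBlock F m n a C) := by
  rw [weightedRank_eq_add a, map_add, eraseBlock_blockSingle, add_zero, Pi.add_apply,
    blockSingle_self]

theorem finrank_eq_component_add_erase (A : Submodule F (Ambient F m n)) (a : Fin ℓ) :
    finrank F A = finrank F (component A a) + finrank F (A.map (eraseBlock F m n a)) := by
  have h := LinearMap.finrank_range_add_finrank_ker ((eraseBlock F m n a).domRestrict A)
  rw [LinearMap.range_domRestrict] at h
  rw [← h, add_comm]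
  congr 1
  have hinj : Function.Injective (blockSingle F m n a) :=
    Pi.single_injective (M := fun i => Matrix (Fin (m i)) (Fin (n i)) F) a
  have e1 : (component A a).map (blockSingle F m n a) =
      (LinearMap.ker ((eraseBlock F m n a).domRestrict A)).map A.subtype := by
    ext C
    simp only [Submodule.mem_map, LinearMap.mem_ker, component, Submodule.mem_comap]
    constructor
    · rintro ⟨X, hX, rfl⟩
      exact ⟨⟨_, hX⟩, eraseBlock_blockSingle a X, rfl⟩
    · rintro ⟨⟨D, hD⟩, h0, rfl⟩
      have h1 : blockSingle F m n a (D a) = D := by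
        have := eraseBlock_add_blockSingle a D
        rwa [show eraseBlock F m n a D = 0 from h0, zero_add] at this
      exact ⟨D a, by rwa [h1], h1⟩
  rw [LinearEquiv.finrank_eq (Submodule.equivMapOfInjective _ hinj (component A a)), e1]
  exact (LinearEquiv.finrank_eq (Submodule.equivMapOfInjective _ A.subtype_injective _))

theorem exists_finrank_le_weightedRank (hnm : ∀ i, n i ≤ m i)
    (A : Submodule F (Ambient F m n)) : ∃ C ∈ A, finrank F A ≤ weightedRank C := by
  classical
  suffices h : ∀ (S : Finset (Fin ℓ)) (A : Submodule F (Ambient F m n)),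
      (∀ C ∈ A, ∀ i ∉ S, C i = 0) → ∃ C ∈ A, finrank F A ≤ weightedRank C from
    h Finset.univ A fun _ _ i hi => absurd (Finset.mem_univ i) hi
  intro S
  induction S using Finset.induction_on with
  | empty =>
    intro A hA
    have : A = ⊥ := (Submodule.eq_bot_iff A).mpr fun C hC => funext fun i => hA C hC i (by simp)
    exact ⟨0, A.zero_mem, by rw [this, finrank_bot]; exact Nat.zero_le _⟩
  | insert a S ha ih =>
    intro A hA
    obtain ⟨c, hc, hle⟩ := ih (A.map (eraseBlock F m n a)) (by
      rintro _ ⟨C, hC, rfl⟩ i hi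
      by_cases hia : i = a
      · subst hia; exact eraseBlock_self _ _
      · rw [eraseBlock_of_ne hia]
        exact hA C hC i (by simp [hia, hi]))
    obtain ⟨C, hC, rfl⟩ := hc
    obtain ⟨X, hX, hXle⟩ := exists_finrank_le_mul_rank (hnm a) (component A a) (C a)
    refine ⟨C + blockSingle F m n a X, A.add_mem hC hX, ?_⟩
    rw [weightedRank_add_blockSingle, finrank_eq_component_add_erase A a]
    exact Nat.add_le_add hXle hle

theorem isOptimalAnticode_iff_isBounded (hnm : ∀ i, n i ≤ m i)
    (A : Submodule F (Ambient F m n)) : IsOptimalAnticode A ↔ IsBounded A := by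
  constructor
  · intro h C hC
    exact h.2 ⟨C, hC, rfl⟩
  · intro h
    refine ⟨?_, ?_⟩
    · obtain ⟨C, hC, hle⟩ := exists_finrank_le_weightedRank hnm A
      exact ⟨C, hC, le_antisymm (h C hC) hle⟩
    · rintro _ ⟨C, hC, rfl⟩
      exact h C hC

/-- Over each projected word, the coset bound lets block `a` contribute at least the dimension of
the component, so only the projected dimension is left for the other blocks. -/
theorem IsBounded.erase (hnm : ∀ i, n i ≤ m i) {A : Submodule F (Ambient F m n)}
    (hA : IsBounded A) (a : Fin ℓ) : IsBounded (A.map (eraseBlock F m n a)) := by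
  rintro _ ⟨C, hC, rfl⟩
  obtain ⟨X, hX, hXle⟩ := exists_finrank_le_mul_rank (hnm a) (component A a) (C a)
  have h := hA _ (A.add_mem hC hX)
  rw [weightedRank_add_blockSingle, finrank_eq_component_add_erase A a] at h
  omega

/-- Over a projected word of maximal weight, the coset bound in block `a` must be an equality. -/
theorem IsBounded.exists_finrank_component_eq (hnm : ∀ i, n i ≤ m i)
    {A : Submodule F (Ambient F m n)} (hA : IsBounded A) (a : Fin ℓ) :
    ∃ r, finrank F (component A a) = m a * r := by
  obtain ⟨_, ⟨C, hC, rfl⟩, hle⟩ := exists_finrank_le_weightedRank hnm (A.map (eraseBlock F m n a))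
  obtain ⟨X, hX, hXle⟩ := exists_finrank_le_mul_rank (hnm a) (component A a) (C a)
  have h := hA _ (A.add_mem hC hX)
  rw [weightedRank_add_blockSingle, finrank_eq_component_add_erase A a] at h
  exact ⟨(C a + X).rank, by omega⟩

theorem IsProduct.erase_le {A : Submodule F (Ambient F m n)} (hA : IsProduct A) (a : Fin ℓ) :
    A.map (eraseBlock F m n a) ≤ A := by
  rintro _ ⟨C, hC, rfl⟩
  rw [eraseBlock_apply]
  exact A.sub_mem hC (hA C hC a)

theorem IsBounded.mul_rank_le_of_isProduct (hnm : ∀ i, n i ≤ m i)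
    {A : Submodule F (Ambient F m n)} (hA : IsBounded A) (hP : IsProduct A) {a : Fin ℓ}
    {X : Matrix (Fin (m a)) (Fin (n a)) F} (hX : X ∈ component A a) :
    m a * X.rank ≤ finrank F (component A a) := by
  obtain ⟨c, hc, hle⟩ := exists_finrank_le_weightedRank hnm (A.map (eraseBlock F m n a))
  have hcA := hP.erase_le a hc
  obtain ⟨C, hC, rfl⟩ := hc
  have h := hA _ (A.add_mem hcA hX)
  have he : eraseBlock F m n a (eraseBlock F m n a C) = eraseBlock F m n a C := by
    rw [eraseBlock_apply a (eraseBlock F m n a C), eraseBlock_self, map_zero, sub_zero]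
  rw [weightedRank_add_blockSingle, finrank_eq_component_add_erase A a, eraseBlock_self,
    zero_add, he] at h
  omega

theorem sum_blockSingle (C : Ambient F m n) : ∑ i, blockSingle F m n i (C i) = C := by
  classical
  exact Finset.univ_sum_single C

theorem IsProduct.le_of_component_le {A B : Submodule F (Ambient F m n)} (hP : IsProduct A)
    (h : ∀ i, component A i ≤ component B i) : A ≤ B := by
  intro C hC
  rw [← sum_blockSingle C]
  exact B.sum_mem fun i _ => h i (hP C hC i)

/-! ### Bounded codes are products. -/

theorem exists_sub_notMem_of_lt {m n : ℕ} (hnm : n ≤ m)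
    {P W : Submodule F (Matrix (Fin m) (Fin n) F)} (hW : ¬ P ≤ W)
    (Y₀ : Matrix (Fin m) (Fin n) F) :
    ∃ Y ∈ P, Y - Y₀ ∉ W ∧ finrank F P ≤ m * Y.rank + 1 := by
  obtain ⟨Z, hZP, hZW⟩ := SetLike.not_le_iff_exists.mp hW
  obtain ⟨g, hgZ, hgW⟩ := Submodule.exists_le_ker_of_notMem hZW
  obtain ⟨Y₁, hY₁, hne⟩ : ∃ Y₁ ∈ P, g Y₁ ≠ g Y₀ := by
    by_cases h : g Y₀ = 0
    · exact ⟨Z, hZP, by rwa [h]⟩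
    · exact ⟨0, P.zero_mem, by rw [map_zero]; exact Ne.symm h⟩
  -- On this coset `g` is constant and differs from `g Y₀`; cutting by one hyperplane accounts for
  -- the `+ 1`.
  obtain ⟨X, hX, hle⟩ := exists_finrank_le_mul_rank hnm (P ⊓ LinearMap.ker g) Y₁
  refine ⟨Y₁ + X, P.add_mem hY₁ hX.1, fun hmem => ?_, ?_⟩
  · have h1 : g (Y₁ + X - Y₀) = 0 := hgW hmem
    have h2 : g X = 0 := hX.2
    rw [map_sub, map_add, h2, add_zero, sub_eq_zero] at h1
    exact hne h1
  · have h1 := Submodule.finrank_sup_add_finrank_inf_eq P (LinearMap.ker g)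
    have h2 := LinearMap.finrank_range_add_finrank_ker g
    have h3 := Submodule.finrank_le (P ⊔ LinearMap.ker g)
    have h4 := Submodule.finrank_le (LinearMap.range g)
    rw [finrank_self] at h4
    omega

/-- In a heaviest word, block `i` can be replaced at the cost of at most one unit of weight, with
the difference avoiding any given subspace that does not contain the component. -/
theorem IsProduct.le_of_sub_mem (hnm : ∀ i, n i ≤ m i) {A B : Submodule F (Ambient F m n)}
    (hP : IsProduct A) (hA : IsBounded A)
    (h : ∀ c ∈ A, ∀ c' ∈ A, finrank F A ≤ weightedRank c + 1 → finrank F A ≤ weightedRank c' + 1 →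
      c' - c ∈ B) : A ≤ B := by
  refine hP.le_of_component_le fun i => ?_
  by_contra hle
  obtain ⟨c, hc, hcle⟩ := exists_finrank_le_weightedRank hnm A
  obtain ⟨Y, hY, hYn, hYle⟩ := exists_sub_notMem_of_lt (hnm i) hle (c i)
  have hci := hA.mul_rank_le_of_isProduct hnm hP (hP c hc i)
  have hc' : c + blockSingle F m n i (Y - c i) ∈ A := by
    refine A.add_mem hc ?_
    rw [map_sub]
    exact A.sub_mem hY (hP c hc i)
  have h1 := h c hc _ hc' (by omega) (by
    rw [weightedRank_add_blockSingle, add_sub_cancel]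
    rw [weightedRank_eq_add i] at hcle
    omega)
  rw [add_sub_cancel_left] at h1
  exact hYn h1

/-- Two codewords whose other blocks have almost maximal weight differ in block `a` by a matrix of
the component, if the field has two elements. -/
theorem IsBounded.sub_mem_component_of_two (hnm : ∀ i, n i ≤ m i) (hF : ∀ x : F, x = 0 ∨ x = 1)
    {A : Submodule F (Ambient F m n)} (hA : IsBounded A) {a : Fin ℓ} (ha : 2 ≤ m a)
    {C C' : Ambient F m n} (hC : C ∈ A) (hC' : C' ∈ A)
    (hw : finrank F (A.map (eraseBlock F m n a)) ≤ weightedRank (eraseBlock F m n a C) + 1)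
    (hw' : finrank F (A.map (eraseBlock F m n a)) ≤ weightedRank (eraseBlock F m n a C') + 1) :
    C' a - C a ∈ component A a := by
  by_contra hn
  obtain ⟨r, hr⟩ := hA.exists_finrank_component_eq hnm a
  have hlt : m a * r < finrank F ↥(component A a ⊔ Submodule.span F {C' a - C a}) := by
    rw [← hr]
    refine Submodule.finrank_lt_finrank_of_lt (lt_of_le_of_ne le_sup_left fun he => hn ?_)
    rw [he]
    exact (le_sup_right : _ ≤ component A a ⊔ Submodule.span F {C' a - C a})
      (Submodule.mem_span_singleton_self _)
  obtain ⟨Y, hY, hYr⟩ := exists_rank_gt_of_lt_finrank (hnm a) _ (C a) hlt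
  obtain ⟨X, hX, Z, hZ, rfl⟩ := Submodule.mem_sup.mp hY
  obtain ⟨t, rfl⟩ := Submodule.mem_span_singleton.mp hZ
  have hmul : m a * (r + 1) ≤ m a * (C a + (X + t • (C' a - C a))).rank :=
    Nat.mul_le_mul_left _ hYr
  rw [Nat.mul_add, mul_one] at hmul
  -- With only two scalars, the matrix of large rank lies in the coset of `C a` or in that of `C'
  -- a`. Either way the gain `m a ≥ 2` outweighs the missing unit.
  rcases hF t with rfl | rfl
  · rw [zero_smul, add_zero] at hmul
    have h := hA _ (A.add_mem hC hX)
    rw [weightedRank_add_blockSingle, finrank_eq_component_add_erase A a] at h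
    omega
  · have he : C a + (X + (1 : F) • (C' a - C a)) = C' a + X := by
      rw [one_smul]; abel
    rw [he] at hmul
    have h := hA _ (A.add_mem hC' hX)
    rw [weightedRank_add_blockSingle, finrank_eq_component_add_erase A a] at h
    omega

theorem IsBounded.mem_component_of_three (hnm : ∀ i, n i ≤ m i) (hF : ∃ b : F, b ≠ 0 ∧ b ≠ 1)
    {A : Submodule F (Ambient F m n)} (hA : IsBounded A) {a : Fin ℓ} (ha : 2 ≤ m a)
    {C : Ambient F m n} (hC : C ∈ A)
    (hw : finrank F (A.map (eraseBlock F m n a)) ≤ weightedRank (eraseBlock F m n a C) + 1) :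
    C a ∈ component A a := by
  by_contra hn
  obtain ⟨r, hr⟩ := hA.exists_finrank_component_eq hnm a
  obtain ⟨X, hX, hXr⟩ := exists_rank_gt_of_notMem hF (hnm a) hn hr.ge
  have hmul : m a * (r + 1) ≤ m a * (C a + X).rank := Nat.mul_le_mul_left _ hXr
  rw [Nat.mul_add, mul_one] at hmul
  have h := hA _ (A.add_mem hC hX)
  rw [weightedRank_add_blockSingle, finrank_eq_component_add_erase A a] at h
  omega

theorem IsBounded.erase_le_of_two_le (hnm : ∀ i, n i ≤ m i)
    {A : Submodule F (Ambient F m n)} (hA : IsBounded A) {a : Fin ℓ} (ha : 2 ≤ m a)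
    (hP : IsProduct (A.map (eraseBlock F m n a))) : A.map (eraseBlock F m n a) ≤ A := by
  refine hP.le_of_sub_mem hnm (hA.erase hnm a) ?_
  rintro _ ⟨C, hC, rfl⟩ _ ⟨C', hC', rfl⟩ hw hw'
  have hd : C' a - C a ∈ component A a := by
    by_cases hF : ∃ b : F, b ≠ 0 ∧ b ≠ 1
    · exact (component A a).sub_mem (hA.mem_component_of_three hnm hF ha hC' hw')
        (hA.mem_component_of_three hnm hF ha hC hw)
    · push Not at hF
      exact hA.sub_mem_component_of_two hnm (fun x => or_iff_not_imp_left.mpr (hF x)) ha hC hC' hw hw'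
  have he : eraseBlock F m n a C' - eraseBlock F m n a C =
      (C' - C) - blockSingle F m n a (C' a - C a) := by
    rw [eraseBlock_apply, eraseBlock_apply, map_sub]; abel
  rw [he]
  exact A.sub_mem (A.sub_mem hC' hC) hd

theorem exists_smul_eq_of_one_by_one {m n : ℕ} (hm : m = 1) (hn : n = 1)
    {X : Matrix (Fin m) (Fin n) F} (hX : X ≠ 0) (Y : Matrix (Fin m) (Fin n) F) :
    ∃ t : F, t • X = Y := by
  subst hm hn
  have h : X 0 0 ≠ 0 := fun h => hX (by ext i j; fin_cases i; fin_cases j; simpa using h)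
  refine ⟨Y 0 0 / X 0 0, ?_⟩
  ext i j
  fin_cases i; fin_cases j
  simp [h]

theorem eq_zero_of_rank_eq_zero {m n : ℕ} {X : Matrix (Fin m) (Fin n) F} (h : X.rank = 0) :
    X = 0 := by
  rw [Matrix.rank, Submodule.finrank_eq_zero, LinearMap.range_eq_bot] at h
  exact Matrix.mulVec_injective (funext fun v => by simpa using LinearMap.congr_fun h v)

/-- All blocks involved are 1 × 1. A nonzero component in `a` is the whole block; if it is zero,
projected words of maximal weight already lie in `A`, and they must be shown to generate the
projection. -/
theorem IsBounded.erase_le_of_eq_one (hnm : ∀ i, n i ≤ m i) (hn : ∀ i, 0 < n i)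
    {A : Submodule F (Ambient F m n)} (hA : IsBounded A) {a : Fin ℓ} {T : Finset (Fin ℓ)}
    (hsupp : ∀ C ∈ A, ∀ i, i ≠ a → i ∉ T → C i = 0)
    (ha : m a = 1) (hT : ∀ i ∈ T, m i = 1)
    (hF : (∃ b : F, b ≠ 0 ∧ b ≠ 1) ∨ T.card ≤ 1)
    (hP : IsProduct (A.map (eraseBlock F m n a))) : A.map (eraseBlock F m n a) ≤ A := by
  have hB := hA.erase hnm a
  have hn1 : ∀ i, m i = 1 → n i = 1 := fun i hi => by have := hnm i; have := hn i; omega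
  by_cases h0 : component A a = ⊥
  · have hmax : ∀ c ∈ A.map (eraseBlock F m n a),
        finrank F (A.map (eraseBlock F m n a)) ≤ weightedRank c → c ∈ A := by
      rintro _ ⟨C, hC, rfl⟩ hle
      have h := hA C hC
      have hmul : m a * (C a).rank = (C a).rank := by simp only [ha, one_mul]
      rw [weightedRank_eq_add a, finrank_eq_component_add_erase A a, h0, finrank_bot, hmul] at h
      rw [eraseBlock_apply, eq_zero_of_rank_eq_zero (X := C a) (by omega), map_zero, sub_zero]
      exact hC
    have hsuppB : ∀ c ∈ A.map (eraseBlock F m n a), ∀ i ∉ T, c i = 0 := by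
      rintro _ ⟨C, hC, rfl⟩ i hi
      by_cases hia : i = a
      · subst hia; exact eraseBlock_self _ _
      · rw [eraseBlock_of_ne hia]; exact hsupp C hC i hia hi
    obtain ⟨c, hc, hcle⟩ := exists_finrank_le_weightedRank hnm (A.map (eraseBlock F m n a))
    rcases hF with ⟨b, hb0, hb1⟩ | hT1
    · refine hP.le_of_component_le fun i X hX => ?_
      by_cases hiT : i ∈ T
      · have hci : finrank F (component (A.map (eraseBlock F m n a)) i) ≤ m i * (c i).rank := by
          have h1 := hB.erase hnm i _ ⟨c, hc, rfl⟩
          rw [weightedRank_eq_add i, finrank_eq_component_add_erase _ i] at hcle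
          omega
        by_cases hc0 : c i = 0
        · rw [hc0, Matrix.rank_zero, mul_zero, Nat.le_zero, Submodule.finrank_eq_zero] at hci
          rw [hci, Submodule.mem_bot] at hX
          rw [hX]; exact Submodule.zero_mem _
        -- Scaling one entry by `b` keeps the weight maximal, and the difference from `c` spans
        -- block `i`.
        · have hc' : c + blockSingle F m n i ((b - 1) • c i) ∈ A := by
            refine hmax _ (Submodule.add_mem _ hc ?_) ?_
            · rw [map_smul]
              exact Submodule.smul_mem _ _ (hP c hc i)
            · have he : c i + (b - 1) • c i = b • c i := by
                rw [sub_smul, one_smul, add_sub_cancel]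
              rw [weightedRank_add_blockSingle, he, rank_smul_of_ne_zero hb0,
                ← weightedRank_eq_add]
              exact hcle
          have h2 := A.sub_mem hc' (hmax c hc hcle)
          rw [add_sub_cancel_left] at h2
          have h3 : (b - 1) • c i ≠ 0 := smul_ne_zero (sub_ne_zero.mpr hb1) hc0
          obtain ⟨t, rfl⟩ := exists_smul_eq_of_one_by_one (hT i hiT) (hn1 i (hT i hiT)) h3 X
          exact (component A i).smul_mem t h2
      · have : X = 0 := by
          have := hsuppB _ hX i hiT
          rwa [blockSingle_self] at this
        rw [this]; exact Submodule.zero_mem _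
    · intro d hd
      rcases eq_or_ne d 0 with rfl | hd0
      · exact A.zero_mem
      · refine hmax d hd ?_
        obtain ⟨i, hdi⟩ := Function.ne_iff.mp hd0
        have hiT : i ∈ T := by
          by_contra hiT
          exact hdi (hsuppB d hd i hiT)
        have hz : eraseBlock F m n i c = 0 := by
          funext j
          by_cases hji : j = i
          · subst hji; exact eraseBlock_self _ _
          · rw [eraseBlock_of_ne hji]
            refine hsuppB c hc j fun hjT => hji ?_
            exact Finset.card_le_one.mp hT1 j hjT i hiT
        have hmul : ∀ k, m i * k = k := fun k => by rw [hT i hiT, one_mul]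
        rw [weightedRank_eq_add i, hz, weightedRank_zero, hmul] at hcle
        rw [weightedRank_eq_add i, hmul]
        have h1 := (c i).rank_le_width
        have h2 := hn1 i (hT i hiT)
        have h3 : (d i).rank ≠ 0 := fun h => hdi (eq_zero_of_rank_eq_zero h)
        omega
  · obtain ⟨X, hX, hX0⟩ := Submodule.exists_mem_ne_zero_of_ne_bot h0
    rintro _ ⟨C, hC, rfl⟩
    rw [eraseBlock_apply]
    obtain ⟨t, ht⟩ := exists_smul_eq_of_one_by_one ha (hn1 a ha) hX0 (C a)
    rw [← ht]
    exact A.sub_mem hC ((component A a).smul_mem t hX)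

/-- Optimal anticodes are products of their components. -/
theorem IsBounded.isProduct (hnm : ∀ i, n i ≤ m i) (hn : ∀ i, 0 < n i)
    (hF : (∃ b : F, b ≠ 0 ∧ b ≠ 1) ∨ (Finset.univ.filter fun i => m i = 1).card ≤ 2)
    {A : Submodule F (Ambient F m n)} (hA : IsBounded A) : IsProduct A := by
  classical
  suffices h : ∀ (S : Finset (Fin ℓ)) (A : Submodule F (Ambient F m n)),
      (∀ C ∈ A, ∀ i ∉ S, C i = 0) → IsBounded A → IsProduct A from
    h Finset.univ A (fun _ _ i hi => absurd (Finset.mem_univ i) hi) hA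
  intro S
  -- Removing a block with the largest `m` first ensures that once `m a = 1`, all remaining blocks
  -- are 1 × 1.
  induction S using Finset.induction_on_max_value m with
  | empty =>
    intro A hA _ C hC i
    rw [hA C hC i (by simp), map_zero]
    exact A.zero_mem
  | insert a T haT hmax ih =>
    intro A hsupp hA
    have hP : IsProduct (A.map (eraseBlock F m n a)) := by
      refine ih _ ?_ (hA.erase hnm a)
      rintro _ ⟨C, hC, rfl⟩ i hi
      by_cases hia : i = a
      · subst hia; exact eraseBlock_self _ _
      · rw [eraseBlock_of_ne hia]
        exact hsupp C hC i (by simp [hia, hi])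
    have hpos : ∀ i, 1 ≤ m i := fun i => (hn i).trans_le (hnm i)
    have hle : A.map (eraseBlock F m n a) ≤ A := by
      by_cases ha : 2 ≤ m a
      · exact hA.erase_le_of_two_le hnm ha hP
      · have ha1 : m a = 1 := by have := hpos a; omega
        have hT : ∀ i ∈ T, m i = 1 := fun i hi => by
          have := hpos i; have := hmax i hi; omega
        refine hA.erase_le_of_eq_one hnm hn (fun C hC i hia hiT => hsupp C hC i (by
          simp [hia, hiT])) ha1 hT (hF.imp_right fun h => ?_) hP
        have h1 : insert a T ⊆ Finset.univ.filter fun i => m i = 1 := by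
          intro i hi
          rcases Finset.mem_insert.mp hi with rfl | hi
          · simpa using ha1
          · simpa using hT i hi
        have h2 := (Finset.card_le_card h1).trans h
        rw [Finset.card_insert_of_notMem haT] at h2
        omega
    intro C hC i
    by_cases hia : i = a
    · subst hia
      have h1 := A.sub_mem hC (hle ⟨C, hC, rfl⟩)
      rwa [eraseBlock_apply, sub_sub_cancel] at h1
    · have h1 := hP _ ⟨C, hC, rfl⟩ i
      rw [eraseBlock_of_ne hia] at h1
      exact hle h1

theorem IsProduct.finrank_eq_sum {A : Submodule F (Ambient F m n)} (hP : IsProduct A) :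
    finrank F A = ∑ i, finrank F (component A i) := by
  classical
  let f : ((i : Fin ℓ) → component A i) →ₗ[F] Ambient F m n :=
    LinearMap.pi fun i => (component A i).subtype ∘ₗ LinearMap.proj i
  have hf : Function.Injective f := by
    intro x y hxy
    funext i
    exact Subtype.ext (congrFun hxy i)
  have hr : LinearMap.range f = A := by
    apply le_antisymm
    · rintro _ ⟨x, rfl⟩
      rw [← sum_blockSingle (f x)]
      exact A.sum_mem fun i _ => (x i).2
    · intro C hC
      exact ⟨fun i => ⟨C i, hP C hC i⟩, rfl⟩
  rw [← hr, LinearMap.finrank_range_of_inj hf, finrank_pi_fintype, hr]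

end SumRank

/-! ### Linearized polynomials, Gabidulin codes and Moore matrices. -/

namespace SumRank

set_option linter.unusedSectionVars false

open Module

theorem linearMap_apply_eq_sum_single {R M : Type*} [Semiring R] [AddCommMonoid M] [Module R M]
    {s : ℕ} (f : (Fin s → R) →ₗ[R] M) (v : Fin s → R) :
    f v = ∑ t, v t • f (Pi.single t 1) := by
  rw [LinearMap.pi_apply_eq_sum_univ]
  refine Finset.sum_congr rfl fun t _ => ?_
  congr 2
  funext j
  simp [Pi.single_apply, eq_comm]

section Linearized

variable {F K : Type*} [Field F] [Fintype F] [Field K] [Algebra F K]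

/-- The map defined by the linearized polynomial with coefficients `f`. -/
def linearizedMap {k : ℕ} (f : Fin k → K) : K →ₗ[F] K :=
  ∑ i, LinearMap.mulLeft F (f i) ∘ₗ (FiniteField.frobeniusAlgHom F K ^ (i : ℕ)).toLinearMap

theorem linearizedMap_apply {k : ℕ} (f : Fin k → K) (x : K) :
    linearizedMap (F := F) f x = ∑ i, f i * x ^ Fintype.card F ^ (i : ℕ) := by
  simp [linearizedMap, LinearMap.sum_apply, AlgHom.coe_pow, FiniteField.coe_frobeniusAlgHom,
    pow_iterate]

/-- The kernel consists of roots of a nonzero polynomial of degree at most `q ^ (k - 1)`, where `q`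
is the order of `F`. -/
theorem finrank_ker_linearizedMap_lt [FiniteDimensional F K] {k : ℕ} {f : Fin k → K}
    (hf : f ≠ 0) : finrank F (LinearMap.ker (linearizedMap (F := F) f)) < k := by
  classical
  have : Finite K := Module.finite_of_finite F
  let : Fintype K := Fintype.ofFinite K
  obtain ⟨j, hj⟩ := Function.ne_iff.mp hf
  set q := Fintype.card F with hq
  have hq1 : 1 < q := Fintype.one_lt_card
  set p : Polynomial K := ∑ i, Polynomial.C (f i) * Polynomial.X ^ q ^ (i : ℕ) with hp
  have hcoeff : p.coeff (q ^ (j : ℕ)) = f j := by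
    rw [hp, Polynomial.finsetSum_coeff, Finset.sum_eq_single j]
    · simp
    · intro i _ hij
      rw [Polynomial.coeff_C_mul_X_pow, if_neg]
      intro h
      exact hij (Fin.ext (Nat.pow_right_injective hq1 h).symm)
    · simp
  have hp0 : p ≠ 0 := by
    intro h
    rw [h, Polynomial.coeff_zero] at hcoeff
    exact hj hcoeff.symm
  have hk : 0 < k := j.pos
  have hdeg : p.natDegree ≤ q ^ (k - 1) := by
    refine Polynomial.natDegree_sum_le_of_forall_le _ _ fun i _ => ?_
    refine (Polynomial.natDegree_C_mul_X_pow_le _ _).trans ?_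
    exact Nat.pow_le_pow_right hq1.le (by omega)
  have hcard : Nat.card (LinearMap.ker (linearizedMap (F := F) f)) ≤ p.natDegree := by
    rw [Nat.card_eq_fintype_card, Fintype.card_subtype]
    refine Polynomial.card_le_degree_of_subset_roots fun x hx => ?_
    rw [Polynomial.mem_roots hp0, Polynomial.IsRoot.def, hp, Polynomial.eval_finsetSum]
    have hx' : linearizedMap (F := F) f x = 0 := by simpa using hx
    rw [linearizedMap_apply] at hx'
    simpa using hx'
  rw [Module.natCard_eq_pow_finrank (K := F), Nat.card_eq_fintype_card] at hcard
  have := (Nat.pow_le_pow_iff_right hq1).mp (hcard.trans hdeg)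
  omega

theorem linearizedMap_add {k : ℕ} (f f' : Fin k → K) :
    linearizedMap (F := F) (f + f') = linearizedMap f + linearizedMap f' := by
  ext1 x
  simp [linearizedMap_apply, add_mul, Finset.sum_add_distrib]

theorem linearizedMap_smul {k : ℕ} (c : F) (f : Fin k → K) :
    linearizedMap (F := F) (c • f) = c • linearizedMap f := by
  ext1 x
  simp [linearizedMap_apply, Finset.smul_sum]

/-- The encoder of a Gabidulin code: it evaluates linearized polynomials on the image of `α`, and
expands the values by means of `g`. -/
noncomputable def gabidulin {m n k : ℕ} (g : K →ₗ[F] (Fin m → F)) (α : (Fin n → F) →ₗ[F] K) :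
    (Fin k → K) →ₗ[F] Matrix (Fin m) (Fin n) F where
  toFun f := LinearMap.toMatrix' (g ∘ₗ linearizedMap f ∘ₗ α)
  map_add' f f' := by
    rw [linearizedMap_add, LinearMap.add_comp, LinearMap.comp_add, map_add]
  map_smul' c f := by
    rw [linearizedMap_smul, LinearMap.smul_comp, LinearMap.comp_smul, map_smul, RingHom.id_apply]

theorem gabidulin_mulVec {m n k : ℕ} (g : K →ₗ[F] (Fin m → F)) (α : (Fin n → F) →ₗ[F] K)
    (f : Fin k → K) (v : Fin n → F) :
    (gabidulin g α f).mulVec v = g (linearizedMap (F := F) f (α v)) :=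
  LinearMap.toMatrix'_mulVec (g ∘ₗ linearizedMap f ∘ₗ α) v

theorem finrank_ker_comp_le {U W : Type*} [AddCommGroup U] [Module F U] [AddCommGroup W]
    [Module F W] [FiniteDimensional F K] (g : K →ₗ[F] W) {α : U →ₗ[F] K}
    (hα : Function.Injective α) :
    finrank F (LinearMap.ker (g ∘ₗ α)) ≤ finrank F (LinearMap.ker g) := by
  have h1 : (LinearMap.ker (g ∘ₗ α)).map α ≤ LinearMap.ker g := by
    rintro _ ⟨x, hx, rfl⟩
    exact hx
  rw [LinearEquiv.finrank_eq (Submodule.equivMapOfInjective α hα _)]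
  exact Submodule.finrank_mono h1

theorem rank_gabidulin [FiniteDimensional F K] {m n k : ℕ} {g : K →ₗ[F] (Fin m → F)}
    (hg : Function.Injective g) {α : (Fin n → F) →ₗ[F] K} (hα : Function.Injective α)
    {f : Fin k → K} (hf : f ≠ 0) : n < (gabidulin g α f).rank + k := by
  have h1 := finrank_ker_linearizedMap_lt (F := F) hf
  have h2 := finrank_ker_comp_le (g ∘ₗ linearizedMap (F := F) f) hα
  rw [LinearMap.ker_comp_of_ker_eq_bot _ (LinearMap.ker_eq_bot.mpr hg)] at h2
  have h3 := LinearMap.finrank_range_add_finrank_ker ((g ∘ₗ linearizedMap (F := F) f) ∘ₗ α)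
  have h4 : (gabidulin g α f).mulVecLin = (g ∘ₗ linearizedMap (F := F) f) ∘ₗ α :=
    LinearMap.ext fun v => gabidulin_mulVec g α f v
  rw [finrank_fin_fun] at h3
  rw [Matrix.rank, h4]
  omega

/-- The coefficients of a functional that vanishes on the Moore matrix of an independent family are
themselves independent. -/
theorem exists_linearIndependent_moore_dual [FiniteDimensional F K] {s : ℕ} {α : Fin s → K}
    (hα : LinearIndependent F α) :
    ∃ β : Fin s → K, LinearIndependent F β ∧
      ∀ i : ℕ, i + 1 < s → ∑ t, β t * α t ^ Fintype.card F ^ i = 0 := by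
  rcases Nat.eq_zero_or_pos s with rfl | hs
  · exact ⟨α, hα, fun i hi => absurd hi (Nat.not_lt_zero _)⟩
  let a : (Fin s → F) →ₗ[F] K := Fintype.linearCombination F α
  have ha : Function.Injective a := by
    exact linearIndependent_iff_injective_fintypeLinearCombination.mp hα
  have ha1 : ∀ t, a (Pi.single t 1) = α t := fun t => by
    simp [a, Fintype.linearCombination_apply_single]
  let E : (Fin (s - 1) → K) →ₗ[K] (Fin s → K) :=
    { toFun := fun f t => linearizedMap (F := F) f (α t)
      map_add' := fun f g => by
        funext t
        simp only [linearizedMap_apply, Pi.add_apply, add_mul, Finset.sum_add_distrib]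
      map_smul' := fun c f => by
        funext t
        simp [linearizedMap_apply, Finset.mul_sum, mul_assoc] }
  have hEinj : Function.Injective E := by
    rw [injective_iff_map_eq_zero]
    intro f hf
    by_contra hne
    have h1 := finrank_ker_linearizedMap_lt (F := F) hne
    have h2 := finrank_ker_comp_le (linearizedMap (F := F) f) ha
    have h3 : linearizedMap (F := F) f ∘ₗ a = 0 := by
      refine (Pi.basisFun F (Fin s)).ext fun t => ?_
      rw [Pi.basisFun_apply, LinearMap.comp_apply, ha1]
      exact congrFun hf t
    rw [h3, LinearMap.ker_zero, finrank_top, finrank_fin_fun] at h2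
    omega
  have hErank : finrank K (LinearMap.range E) = s - 1 := by
    rw [LinearMap.finrank_range_of_inj hEinj, finrank_fin_fun]
  have hElt : LinearMap.range E < ⊤ := by
    rw [lt_top_iff_ne_top]
    intro h
    rw [h, finrank_top, finrank_fin_fun] at hErank
    omega
  obtain ⟨B, hB0, hBE⟩ := Submodule.exists_le_ker_of_lt_top _ hElt
  have hBapply : ∀ v, B v = ∑ t, B (Pi.single t 1) * v t := by
    intro v
    rw [linearMap_apply_eq_sum_single B v]
    refine Finset.sum_congr rfl fun t _ => ?_
    rw [smul_eq_mul, mul_comm]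
  have hker : LinearMap.range E = LinearMap.ker B := by
    refine Submodule.eq_of_le_of_finrank_le hBE ?_
    have h1 := LinearMap.finrank_range_add_finrank_ker B
    have h2 : finrank K (LinearMap.range B) = 1 := by
      rw [LinearMap.range_eq_top.mpr (LinearMap.surjective hB0), finrank_top, finrank_self]
    rw [finrank_fin_fun] at h1
    omega
  refine ⟨fun t => B (Pi.single t 1), ?_, ?_⟩
  · rw [Fintype.linearIndependent_iff]
    intro c hc t
    by_contra hct
    have hmem : (fun t => algebraMap F K (c t)) ∈ LinearMap.range E := by
      rw [hker, LinearMap.mem_ker, hBapply]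
      rw [← hc]
      refine Finset.sum_congr rfl fun t _ => ?_
      rw [Algebra.smul_def, mul_comm]
    obtain ⟨f, hf⟩ := hmem
    have hft : ∀ t, linearizedMap (F := F) f (α t) = algebraMap F K (c t) := congrFun hf
    have hf0 : f ≠ 0 := by
      rintro rfl
      have := hft t
      rw [linearizedMap_apply] at this
      simp only [Pi.zero_apply, zero_mul, Finset.sum_const_zero] at this
      exact hct ((algebraMap F K).injective (by rw [← this, map_zero]))
    have h1 := finrank_ker_linearizedMap_lt (F := F) hf0
    have h2 := finrank_ker_comp_le (linearizedMap (F := F) f) ha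
    -- A relation among the `β t` over `F` gives a linearized map sending all `α t` into `F`. It has
    -- rank at most one on an `s`-dimensional space, while its kernel has dimension below `s - 1`.
    have h3 : linearizedMap (F := F) f ∘ₗ a =
        Algebra.linearMap F K ∘ₗ Fintype.linearCombination F c := by
      refine (Pi.basisFun F (Fin s)).ext fun t => ?_
      rw [Pi.basisFun_apply, LinearMap.comp_apply, ha1, hft]
      simp [Fintype.linearCombination_apply_single]
    have h4 := LinearMap.finrank_range_add_finrank_ker (linearizedMap (F := F) f ∘ₗ a)
    have h5 : finrank F (LinearMap.range (linearizedMap (F := F) f ∘ₗ a)) ≤ 1 := by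
      rw [h3, LinearMap.range_comp]
      refine (Submodule.finrank_map_le _ _).trans ((Submodule.finrank_le _).trans ?_)
      rw [finrank_self]
    rw [finrank_fin_fun] at h4
    omega
  · intro i hi
    have hmem : E (Pi.single ⟨i, by omega⟩ 1) ∈ LinearMap.ker B := hBE ⟨_, rfl⟩
    rw [LinearMap.mem_ker, hBapply] at hmem
    rw [← hmem]
    refine Finset.sum_congr rfl fun t _ => ?_
    congr 1
    change _ = linearizedMap (F := F) _ (α t)
    rw [linearizedMap_apply, Finset.sum_eq_single ⟨i, by omega⟩]
    · simp
    · intro j _ hj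
      rw [Pi.single_eq_of_ne hj, zero_mul]
    · simp

end Linearized

/-! ### Duality in one block. -/

theorem sumExtend_inl {F U : Type*} [Field F] [AddCommGroup U] [Module F U] {ι : Type*}
    {u : ι → U} (hu : LinearIndependent F u) (t : ι) : Basis.sumExtend hu (Sum.inl t) = u t := by
  simp only [Basis.sumExtend, Basis.reindex_apply]
  rw [Basis.extend_apply_self]
  rfl

theorem exists_injective_extension {F U W : Type*} [Field F] [AddCommGroup U] [Module F U]
    [FiniteDimensional F U] [AddCommGroup W] [Module F W] [FiniteDimensional F W] {s : ℕ}
    {u : Fin s → U} {w : Fin s → W} (hu : LinearIndependent F u) (hw : LinearIndependent F w)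
    (h : finrank F U ≤ finrank F W) :
    ∃ g : U →ₗ[F] W, Function.Injective g ∧ ∀ t, g (u t) = w t := by
  classical
  let b := Basis.sumExtend hu
  let b' := Basis.sumExtend hw
  have hfin : Finite (Fin s ⊕ Basis.sumExtendIndex hu) := Module.Finite.finite_basis b
  have hfin' : Finite (Fin s ⊕ Basis.sumExtendIndex hw) := Module.Finite.finite_basis b'
  have hf1 : Finite (Basis.sumExtendIndex hu) := Finite.of_injective _ (Sum.inr_injective (α := Fin s))
  have hf2 : Finite (Basis.sumExtendIndex hw) := Finite.of_injective _ (Sum.inr_injective (α := Fin s))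
  have hcard : Nat.card (Basis.sumExtendIndex hu) ≤ Nat.card (Basis.sumExtendIndex hw) := by
    rw [finrank_eq_nat_card_basis b, finrank_eq_nat_card_basis b', Nat.card_sum, Nat.card_sum] at h
    omega
  let : Fintype (Basis.sumExtendIndex hu) := Fintype.ofFinite _
  let : Fintype (Basis.sumExtendIndex hw) := Fintype.ofFinite _
  rw [Nat.card_eq_fintype_card, Nat.card_eq_fintype_card] at hcard
  obtain ⟨e⟩ := Function.Embedding.nonempty_of_card_le hcard
  have hinj : Function.Injective (Sum.map (id : Fin s → Fin s) e) :=
    Function.injective_id.sumMap e.injective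
  refine ⟨b.constr F (b' ∘ Sum.map id e),
    b.injective_constr_of_linearIndependent (b'.linearIndependent.comp _ hinj), fun t => ?_⟩
  have h1 : ∀ t, b (Sum.inl t) = u t := fun t => by
    exact sumExtend_inl hu t
  have h2 : ∀ t, b' (Sum.inl t) = w t := fun t => by
    exact sumExtend_inl hw t
  rw [← h1, Basis.constr_basis, ← h2]
  rfl

theorem exists_rank_factorization {F : Type*} [Field F] {m n : ℕ} (D : Matrix (Fin m) (Fin n) F) :
    ∃ (p : Fin D.rank → Fin m → F) (q : Fin D.rank → Fin n → F),
      LinearIndependent F p ∧ LinearIndependent F q ∧ ∀ i j, D i j = ∑ t, p t i * q t j := by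
  let S := Submodule.span F (Set.range D.row)
  have hS : finrank F S = D.rank := (D.rank_eq_finrank_span_row).symm
  let b : Basis (Fin D.rank) F S := (finBasis F S).reindex (finCongr hS)
  have hmem : ∀ i, D i ∈ S := fun i => Submodule.subset_span ⟨i, rfl⟩
  let P : Matrix (Fin m) (Fin D.rank) F := fun i t => b.repr ⟨D i, hmem i⟩ t
  let Q : Matrix (Fin D.rank) (Fin n) F := fun t => (b t : Fin n → F)
  have hD : D = P * Q := by
    ext i j
    have h1 := b.sum_repr ⟨D i, hmem i⟩
    have h2 := congrFun (congrArg Subtype.val h1) j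
    simp only [Submodule.coe_sum, Submodule.coe_smul, Finset.sum_apply, Pi.smul_apply,
      smul_eq_mul] at h2
    rw [Matrix.mul_apply]
    exact h2.symm
  refine ⟨fun t i => P i t, Q, ?_, ?_, fun i j => ?_⟩
  · rw [linearIndependent_iff_card_le_finrank_span, Fintype.card_fin]
    have h1 : D.rank ≤ P.rank := by
      conv_lhs => rw [hD]
      exact Matrix.rank_mul_le_left P Q
    rw [P.rank_eq_finrank_span_cols] at h1
    exact h1
  · exact b.linearIndependent.map' S.subtype S.ker_subtype
  · conv_lhs => rw [hD]
    exact Matrix.mul_apply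

theorem exists_finite_extension (F : Type*) [Field F] [Finite F] {m : ℕ} (hm : 0 < m) :
    ∃ (K : Type) (_ : Field K) (_ : Algebra F K), FiniteDimensional F K ∧ finrank F K = m := by
  obtain ⟨p, hp⟩ := CharP.exists F
  have : Fact p.Prime := ⟨(CharP.char_is_prime_or_zero F p).resolve_right
    (CharP.char_ne_zero_of_finite F p)⟩
  have : NeZero m := ⟨hm.ne'⟩
  exact ⟨FiniteField.Extension F p m, inferInstance, inferInstance, inferInstance,
    FiniteField.finrank_extension F p m⟩

theorem sup_range_eq_top_of_finrank {F U V : Type*} [Field F] [AddCommGroup U] [Module F U]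
    [FiniteDimensional F U] [AddCommGroup V] [Module F V] [FiniteDimensional F V]
    {A : Submodule F V} (f : U →ₗ[F] V) (h : ∀ x, f x ∈ A → x = 0)
    (hfin : finrank F A + finrank F U = finrank F V) : A ⊔ LinearMap.range f = ⊤ := by
  have hinj : Function.Injective f := by
    rw [injective_iff_map_eq_zero]
    exact fun x hx => h x (by rw [hx]; exact A.zero_mem)
  have hdisj : A ⊓ LinearMap.range f = ⊥ := by
    rw [eq_bot_iff]
    rintro _ ⟨hM, x, rfl⟩
    rw [h x hM, map_zero]
    exact Submodule.zero_mem _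
  have h1 := Submodule.finrank_sup_add_finrank_inf_eq A (LinearMap.range f)
  rw [hdisj, finrank_bot, add_zero, LinearMap.finrank_range_of_inj hinj, hfin] at h1
  exact Submodule.eq_top_of_finrank_eq h1

theorem trace_mul_transpose_of_factorization {F : Type*} [Field F] {m n s : ℕ}
    {D : Matrix (Fin m) (Fin n) F} {p : Fin s → Fin m → F} {q : Fin s → Fin n → F}
    (h : ∀ i j, D i j = ∑ t, p t i * q t j) (M : Matrix (Fin m) (Fin n) F) :
    (D * M.transpose).trace = ∑ t, ∑ i, p t i * M.mulVec (q t) i := by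
  simp only [Matrix.trace, Matrix.diag_apply, Matrix.mul_apply, Matrix.transpose_apply, h,
    Matrix.mulVec, dotProduct, Finset.mul_sum, Finset.sum_mul]
  rw [Finset.sum_comm (s := (Finset.univ : Finset (Fin s)))]
  refine Finset.sum_congr rfl fun i _ => ?_
  rw [Finset.sum_comm]
  refine Finset.sum_congr rfl fun t _ => Finset.sum_congr rfl fun j _ => ?_
  ring

/-- The dual of an optimal anticode in one block has small rank. -/
theorem rank_add_le_of_trace_eq_zero {F : Type*} [Field F] [Finite F] {m n r : ℕ} (hm : 0 < m)
    (hnm : n ≤ m) {A : Submodule F (Matrix (Fin m) (Fin n) F)} (hA : finrank F A = m * r)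
    (hr : ∀ X ∈ A, X.rank ≤ r) {D : Matrix (Fin m) (Fin n) F}
    (hD : ∀ C ∈ A, (D * C.transpose).trace = 0) : D.rank + r ≤ n := by
  classical
  let : Fintype F := Fintype.ofFinite F
  by_contra! hlt
  have hrn : r ≤ n := by
    have h := Submodule.finrank_le A
    rw [hA, finrank_matrix, finrank_self, mul_one, Fintype.card_fin, Fintype.card_fin] at h
    exact Nat.le_of_mul_le_mul_left h hm
  obtain ⟨K, _, _, _, hK⟩ := exists_finite_extension F hm
  obtain ⟨p, q, hp, hq, hpq⟩ := exists_rank_factorization D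
  have hDm : D.rank ≤ m := D.rank_le_width.trans hnm
  obtain ⟨α₀, hα₀⟩ : ∃ α₀ : Fin D.rank → K, LinearIndependent F α₀ :=
    exists_linearIndependent_of_finrank_gt (fun _ => ⊤) (fun t => by
      rw [finrank_top, hK]; have := t.2; omega) |>.imp fun _ h => h.2
  obtain ⟨β, hβ, hβα⟩ := exists_linearIndependent_moore_dual hα₀
  obtain ⟨α, hα, hαq⟩ := exists_injective_extension hq hα₀ (by
    rw [hK, finrank_fin_fun]; exact hnm)
  obtain ⟨τ, hτ⟩ : ∃ τ : K →ₗ[F] F, τ ≠ 0 := exists_ne 0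
  -- If `∑ t, c t • β t` were nonzero, dividing by it would make `τ` vanish everywhere.
  have hτβ : LinearIndependent F fun t => τ ∘ₗ LinearMap.mulLeft F (β t) := by
    rw [Fintype.linearIndependent_iff] at hβ ⊢
    intro c hc
    refine hβ c ?_
    by_contra hne
    refine hτ (LinearMap.ext fun z => ?_)
    have h1 := LinearMap.congr_fun hc ((∑ t, c t • β t)⁻¹ * z)
    rw [LinearMap.zero_apply] at h1 ⊢
    rw [← h1, LinearMap.sum_apply]
    simp only [LinearMap.smul_apply, LinearMap.comp_apply, LinearMap.mulLeft_apply, ← map_smul,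
      ← map_sum, ← smul_mul_assoc, ← Finset.sum_mul]
    rw [mul_inv_cancel_left₀ hne]
  obtain ⟨γ, hγ, hγp⟩ := exists_injective_extension hp hτβ (by
    rw [finrank_linearMap, finrank_self, mul_one, hK, finrank_fin_fun])
  have hγs : Function.Surjective γ :=
    (LinearMap.injective_iff_surjective_of_finrank_eq_finrank (by
      rw [finrank_linearMap, finrank_self, mul_one, hK, finrank_fin_fun])).mp hγ
  -- `g` is the transpose of `γ`: pairing `g z` with `p t` gives `τ (β t * z)`. Together with `α`
  -- sending `q t` to `α₀ t`, this adapts the Gabidulin code to the factorization of `D`.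
  let g : K →ₗ[F] (Fin m → F) := LinearMap.pi fun i => γ (Pi.single i 1)
  have hg : ∀ (v : Fin m → F) (z : K), ∑ i, v i * g z i = γ v z := by
    intro v z
    rw [linearMap_apply_eq_sum_single γ v, LinearMap.sum_apply]
    rfl
  have hginj : Function.Injective g := by
    rw [injective_iff_map_eq_zero]
    intro z hz
    rw [← forall_dual_apply_eq_zero_iff F]
    intro φ
    obtain ⟨v, rfl⟩ := hγs φ
    rw [← hg, hz]
    simp
  -- With `n - r` coefficients, nonzero Gabidulin words have rank above `r`, and the dimension `m *
  -- (n - r)` is exactly complementary to that of `A`.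
  have hker : ∀ f : Fin (n - r) → K, gabidulin g α f ∈ A → f = 0 := by
    intro f hf
    by_contra hne
    have h1 := rank_gabidulin hginj hα hne
    have h2 := hr _ hf
    omega
  have htop : A ⊔ LinearMap.range (gabidulin (k := n - r) g α) = ⊤ := by
    refine sup_range_eq_top_of_finrank _ hker ?_
    rw [finrank_pi_fintype, finrank_matrix, hA]
    simp only [hK, Finset.sum_const, Finset.card_univ, Fintype.card_fin, finrank_self, mul_one,
      smul_eq_mul]
    rw [mul_comm (n - r), ← mul_add, Nat.add_sub_cancel' hrn]
  have hΨD : ∀ f : Fin (n - r) → K, (D * (gabidulin g α f).transpose).trace = 0 := by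
    intro f
    rw [trace_mul_transpose_of_factorization hpq]
    simp only [gabidulin_mulVec, hαq, hg, hγp, LinearMap.comp_apply, LinearMap.mulLeft_apply,
      linearizedMap_apply]
    rw [← map_sum]
    simp only [Finset.mul_sum]
    rw [Finset.sum_comm]
    have h3 : ∀ i : Fin (n - r), ∑ t, β t * (f i * α₀ t ^ Fintype.card F ^ (i : ℕ)) = 0 := by
      intro i
      -- The assumption `n - r < D.rank` is what places every exponent `i < n - r` in the range of
      -- the Moore relations.
      have h4 := hβα i (by have := i.2; omega)
      rw [← mul_zero (f i), ← h4, Finset.mul_sum]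
      refine Finset.sum_congr rfl fun t _ => ?_
      ring
    rw [Finset.sum_congr rfl fun i _ => h3 i, Finset.sum_const_zero, map_zero]
  have hall : ∀ M : Matrix (Fin m) (Fin n) F, (D * M.transpose).trace = 0 := by
    intro M
    have hM : M ∈ A ⊔ LinearMap.range (gabidulin (k := n - r) g α) := by
      rw [htop]; exact Submodule.mem_top
    obtain ⟨X, hX, Y, ⟨f, rfl⟩, rfl⟩ := Submodule.mem_sup.mp hM
    rw [Matrix.transpose_add, Matrix.mul_add, Matrix.trace_add, hD X hX, hΨD, add_zero]
  have hD0 : D = 0 := by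
    rw [Matrix.ext_iff_trace_mul_right]
    intro M
    have := hall M.transpose
    rw [Matrix.transpose_transpose] at this
    rw [this, Matrix.zero_mul, Matrix.trace_zero]
  rw [hD0, Matrix.rank_zero] at hlt
  omega

end SumRank

/-! ### The trace form and the dual of a bounded code. -/

namespace SumRank

open Module

variable {F : Type*} [Field F] {ℓ : ℕ} {m n : Fin ℓ → ℕ}

theorem traceForm_comm (D C : Ambient F m n) : traceForm D C = traceForm C D := by
  refine Finset.sum_congr rfl fun i _ => ?_
  rw [← Matrix.trace_transpose, Matrix.transpose_mul, Matrix.transpose_transpose]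

/-- The trace form as a bilinear form. -/
def traceBilin (F : Type*) [Field F] {ℓ : ℕ} (m n : Fin ℓ → ℕ) :
    LinearMap.BilinForm F (Ambient F m n) :=
  LinearMap.mk₂ F traceForm
    (fun D E C => by simp [traceForm, Matrix.add_mul, Finset.sum_add_distrib])
    (fun c D C => by simp [traceForm, Finset.mul_sum])
    (fun D C E => by simp [traceForm, Matrix.mul_add, Finset.sum_add_distrib])
    (fun c D C => by simp [traceForm, Finset.mul_sum])

theorem traceBilin_apply (D C : Ambient F m n) : traceBilin F m n D C = traceForm D C := rfl

theorem traceForm_blockSingle (D : Ambient F m n) (i : Fin ℓ)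
    (X : Matrix (Fin (m i)) (Fin (n i)) F) :
    traceForm D (blockSingle F m n i X) = (D i * X.transpose).trace := by
  rw [traceForm, Finset.sum_eq_single i]
  · rw [blockSingle_self]
  · intro j _ hj
    rw [blockSingle_of_ne hj, Matrix.transpose_zero, Matrix.mul_zero, Matrix.trace_zero]
  · simp

theorem traceBilin_isSymm : (traceBilin F m n).IsSymm := ⟨fun D C => traceForm_comm D C⟩

theorem traceBilin_nondegenerate : (traceBilin F m n).Nondegenerate := by
  refine (LinearMap.IsRefl.nondegenerate_iff_separatingLeft (B := traceBilin F m n)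
    fun D C h => ?_).mpr fun D hD => ?_
  · rw [traceBilin_apply, traceForm_comm]; exact h
  funext i
  refine (Matrix.ext_iff_trace_mul_right (A := D i) (B := 0)).mpr fun X => ?_
  have h := hD (blockSingle F m n i X.transpose)
  rw [traceBilin_apply, traceForm_blockSingle, Matrix.transpose_transpose] at h
  rw [h, Matrix.zero_mul, Matrix.trace_zero]

theorem dual_eq_orthogonal (A : Submodule F (Ambient F m n)) :
    dual A = (traceBilin F m n).orthogonal A := by
  ext D
  refine forall₂_congr fun C _ => ?_
  rw [traceForm_comm]
  rfl

theorem dual_dual (A : Submodule F (Ambient F m n)) : dual (dual A) = A := by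
  rw [dual_eq_orthogonal, dual_eq_orthogonal]
  exact LinearMap.BilinForm.orthogonal_orthogonal traceBilin_nondegenerate
    traceBilin_isSymm.isRefl A

theorem finrank_ambient : finrank F (Ambient F m n) = ∑ i, m i * n i := by
  rw [finrank_pi_fintype]
  simp [finrank_matrix]

theorem finrank_dual (A : Submodule F (Ambient F m n)) :
    finrank F (dual A) = ∑ i, m i * n i - finrank F A := by
  rw [dual_eq_orthogonal, LinearMap.BilinForm.finrank_orthogonal traceBilin_nondegenerate,
    finrank_ambient]

/-- Each block of a dual word is orthogonal to the matching component, so the one-block bound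
applies; since the code is a product, the component dimensions add up to its dimension. -/
theorem IsBounded.dual [Finite F] (hn : ∀ i, 0 < n i) (hnm : ∀ i, n i ≤ m i)
    (hF : (∃ b : F, b ≠ 0 ∧ b ≠ 1) ∨ (Finset.univ.filter fun i => m i = 1).card ≤ 2)
    {A : Submodule F (Ambient F m n)} (hA : IsBounded A) : IsBounded (dual A) := by
  have hP := hA.isProduct hnm hn hF
  intro D hD
  have hi : ∀ i, m i * (D i).rank + finrank F (component A i) ≤ m i * n i := by
    intro i
    have hmi : 0 < m i := (hn i).trans_le (hnm i)
    obtain ⟨r, hr⟩ := hA.exists_finrank_component_eq hnm i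
    have h := rank_add_le_of_trace_eq_zero hmi (hnm i) hr
      (fun X hX => Nat.le_of_mul_le_mul_left
        ((hA.mul_rank_le_of_isProduct hnm hP hX).trans hr.le) hmi)
      (D := D i) (fun X hX => by rw [← traceForm_blockSingle]; exact hD _ hX)
    rw [hr, ← mul_add]
    exact Nat.mul_le_mul_left _ h
  have hsum := Finset.sum_le_sum fun i (_ : i ∈ Finset.univ) => hi i
  rw [Finset.sum_add_distrib, ← hP.finrank_eq_sum] at hsum
  rw [finrank_dual]
  exact Nat.le_sub_of_add_le hsum

/-- With indices from zero, `ℓ - 3` is the third block from the end; by monotonicity only the two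
blocks after it can have `m i = 1`. -/
theorem card_filter_eq_one_le_two (hm : Antitone m)
    (h : ∀ i : Fin ℓ, (i : ℕ) + 3 = ℓ → 1 < m i) :
    (Finset.univ.filter fun i => m i = 1).card ≤ 2 := by
  have hsub : ∀ i ∈ Finset.univ.filter fun i => m i = 1, (i.rev : ℕ) < 2 := by
    intro i hi
    have hi1 : m i = 1 := by simpa using hi
    by_contra hlt
    rw [Fin.val_rev] at hlt
    have h1 := h ⟨ℓ - 3, by omega⟩ (by simp only; omega)
    have h2 : m ⟨ℓ - 3, by omega⟩ ≤ m i := hm (Fin.le_def.mpr (by simp only; omega))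
    omega
  have h5 := Finset.card_le_card_of_injOn (t := Finset.range 2) (fun i : Fin ℓ => (i.rev : ℕ))
    (fun i hi => Finset.mem_coe.mpr (Finset.mem_range.mpr (hsub i hi)))
    (fun a _ b _ hab => Fin.rev_injective (Fin.ext hab))
  simpa using h5

end SumRank

theorem mainTheorem11 {F : Type*} [Field F] [Fintype F] {ℓ : ℕ} (hℓ : 0 < ℓ)
    (m n : Fin ℓ → ℕ) (hn : ∀ i, 0 < n i) (hnm : ∀ i, n i ≤ m i) (hm : Antitone m)
    (h : Fintype.card F ≠ 2 ∨ ∀ i : Fin ℓ, (i : ℕ) + 3 = ℓ → 1 < m i)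
    (A : Submodule F (SumRank.Ambient F m n)) :
    SumRank.IsOptimalAnticode A ↔ SumRank.IsOptimalAnticode (SumRank.dual A) := by
  classical
  have hF : (∃ b : F, b ≠ 0 ∧ b ≠ 1) ∨ (Finset.univ.filter fun i => m i = 1).card ≤ 2 := by
    refine h.imp (fun hq => ?_)
      (SumRank.card_filter_eq_one_le_two hm)
    have h1 : 1 < Fintype.card F := Fintype.one_lt_card
    have h2 : ({0, 1} : Finset F).card < Fintype.card F := by
      rw [Finset.card_pair zero_ne_one]; omega
    obtain ⟨b, hb⟩ := Finset.exists_mem_notMem_of_card_lt_card (t := Finset.univ) h2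
    exact ⟨b, by simpa [not_or] using hb⟩
  rw [SumRank.isOptimalAnticode_iff_isBounded hnm, SumRank.isOptimalAnticode_iff_isBounded hnm]
  refine ⟨fun hA => hA.dual hn hnm hF, fun hA => ?_⟩
  rw [← SumRank.dual_dual A]
  exact hA.dual hn hnm hF
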